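/- Let $\varepsilon,\tilde\varepsilon>0$. For $\theta\in l_2=\{\theta\in\mathbb R^\infty:\sum_{i\ge1}\theta_i^2<\infty\}$ let $P_\theta=\bigotimes_{i\ge1}\mathcal N(\theta_i,\varepsilon^2)$ be the law of the current observation $X$ and $Q_\theta=\bigotimes_{i\ge1}\mathcal N(\theta_i,\tilde\varepsilon^2)$ the law of the future observation $Y$ on $\mathbb R^\infty$. A predictive distribution is a map $x\mapsto\widehat Q(\cdot\,;x)$ from $\mathbb R^\infty$ to the probability measures on $\mathbb R^\infty$, with Kullback--Leibler risk $$R(\theta,\widehat Q)=\int D_{\mathrm{KL}}\bigl(Q_\theta\,\|\,\widehat Q(\cdot\,;x)\bigr)\,\mathrm dP_\theta(x)\in[0,\infty].$$ The Bayesian predictive distribution $Q_\Pi(\cdot|X)$ of a (possibly improper) prior $\Pi$ is the average of $Q_\theta$ over the posterior of $\theta$ given $X$. Let $d\ge1$ and divide $\{1,\dots,d\}$ into $J$ consecutive non-empty blocks $B_1,\dots,B_J$ of sizes $b_1,\dots,b_J$; put $\theta_{B_j}=(\theta_i)_{i\in B_j}$. Let $$h(\theta_1,\dots,\theta_d)=\prod_{j:\,b_j>2}\|\theta_{B_j}\|^{2-b_j}$$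 ($\|\cdot\|$ the Euclidean norm) be the blockwise Stein prior density with respect to Lebesgue measure on $\mathbb R^d$, and let $$Q_h(\cdot|X)=\Bigl(\int\bigotimes_{i=1}^d\mathcal N(\theta_i,\tilde\varepsilon^2)\;h(\theta^{(d)}|X^{(d)})\,\mathrm d\theta^{(d)}\Bigr)\otimes\bigotimes_{i>d}\mathcal N(0,\tilde\varepsilon^2)$$ be the blockwise Stein predictive distribution, where $h(\cdot|X^{(d)})$ is the posterior density given $X^{(d)}=(X_1,\dots,X_d)$. Let $\mathcal G_{\mathrm{mon}}$ be the set of the Bayesian predictive distributions $Q_{\mathrm G_\tau}$ of the Gaussian priors $\mathrm G_\tau=\bigotimes_{i\ge1}\mathcal N(0,\tau_i^2)$ with $\tau_1\ge\tau_2\ge\dots\ge\tau_d\ge0$ and $\tau_i=0$ for $i>d$ (where $\mathcal N(0,0)$ is the point mass at $0$). Put $$v_\varepsilon^2=\varepsilon^2,\qquad v_{\varepsilon,\tilde\varepsilon}^2=\frac1{1/\varepsilon^2+1/\tilde\varepsilon^2}.$$ Suppose that $\max_{1\le j\le J-1}b_{j+1}/b_j\le1+\eta$ for some $\eta>0$ (no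 condition if $J=1$). Then for every $\theta\in l_2$, $$R(\theta,Q_h)\le(1+\eta)\inf_{\widehat Q\in\mathcal G_{\mathrm{mon}}}R(\theta,\widehat Q)+\Bigl(J+\frac{b_1}2\Bigr)\log\frac{v_\varepsilon^2}{v_{\varepsilon,\tilde\varepsilon}^2}.$$ -/

import Mathlib

open MeasureTheory ProbabilityTheory
open scoped ENNReal NNReal

noncomputable section

namespace SeqPrediction

/-- The law `⊗_i N(θ_i, σ²)` on `ℝ^∞`. The observation has law `P_θ = seqLaw ε θ` and the future
observation has law `Q_θ = seqLaw ε' θ`. -/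
def seqLaw (σ : ℝ) (θ : ℕ → ℝ) : Measure (ℕ → ℝ) :=
  Measure.infinitePi fun i => gaussianReal (θ i) (σ ^ 2).toNNReal

/-- The Kullback--Leibler risk of a predictive distribution `Q`, where `Q x` is the estimate of the
law of the future observation from the current observation `x`. -/
def risk (ε ε' : ℝ) (θ : ℕ → ℝ) (Q : (ℕ → ℝ) → Measure (ℕ → ℝ)) : ℝ≥0∞ :=
  ∫⁻ x, InformationTheory.klDiv (seqLaw ε' θ) (Q x) ∂(seqLaw ε θ)

/-- The likelihood of the first `d` coordinates, `∏_{i<d} φ(x_i; θ_i, ε²)`. -/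
def likelihood (ε : ℝ) (d : ℕ) (x θ : ℕ → ℝ) : ℝ≥0∞ :=
  ∏ i ∈ Finset.range d, gaussianPDF (θ i) (ε ^ 2).toNNReal (x i)

/-- Posterior (Bayes' formula) for a possibly improper prior `prior` on `ℝ^∞` that is concentrated on
the sequences with `θ_i = 0` for `i ≥ d`. For such `θ` the coordinates `x_i` with `i ≥ d` have a law
that does not depend on `θ`, so only the first `d` coordinates enter the likelihood
(`dP_θ/dP_0` is `likelihood ε d x θ / likelihood ε d x 0`). -/
def posteriorMeasure (ε : ℝ) (d : ℕ) (prior : Measure (ℕ → ℝ)) (x : ℕ → ℝ) : Measure (ℕ → ℝ) :=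
  (∫⁻ θ, likelihood ε d x θ ∂prior)⁻¹ • prior.withDensity (likelihood ε d x)

/-- The Bayesian predictive distribution: the average of `Q_θ` over the posterior. -/
def bayesPredictive (ε ε' : ℝ) (d : ℕ) (prior : Measure (ℕ → ℝ)) (x : ℕ → ℝ) : Measure (ℕ → ℝ) :=
  (posteriorMeasure ε d prior x).bind (seqLaw ε')

/-- The Gaussian prior `G_τ = ⊗_i N(0, τ_i²)`; a coordinate with `τ_i = 0` is a point mass at `0`. -/
def gaussianPrior (τ : ℕ → ℝ) : Measure (ℕ → ℝ) :=
  Measure.infinitePi fun i => gaussianReal 0 (τ i ^ 2).toNNReal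

/-- The sequences `(τ_1, …, τ_d, 0, 0, …)` with `τ_1 ≥ τ_2 ≥ ⋯ ≥ τ_d ≥ 0`. -/
def monotoneScales (d : ℕ) : Set (ℕ → ℝ) :=
  {τ | (∀ i j, i ≤ j → j < d → τ j ≤ τ i) ∧ (∀ i, i < d → 0 ≤ τ i) ∧ ∀ i, d ≤ i → τ i = 0}

/-- The class `G_mon` of Bayesian predictive distributions for Gaussian priors with monotone
variances. -/
def monotoneClass (ε ε' : ℝ) (d : ℕ) : Set ((ℕ → ℝ) → Measure (ℕ → ℝ)) :=
  (fun τ => bayesPredictive ε ε' d (gaussianPrior τ)) '' monotoneScales d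

/-- The sequence `(θ_1, …, θ_d, 0, 0, …)`. -/
def zeroExtend (d : ℕ) (θ : Fin d → ℝ) : ℕ → ℝ :=
  fun i => if h : i < d then θ ⟨i, h⟩ else 0

/-- The Euclidean norm `‖θ_{B_j}‖` of the `j`-th block. A division of the `d` coordinates into
consecutive non-empty blocks is a composition `c` of `d`. -/
def blockNorm {d : ℕ} (c : Composition d) (θ : Fin d → ℝ) (j : Fin c.length) : ℝ :=
  Real.sqrt (∑ k : Fin (c.blocksFun j), θ (c.embedding j k) ^ 2)

/-- The blockwise Stein density `∏_{j : b_j > 2} ‖θ_{B_j}‖^{2 - b_j}`. -/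
def steinDensity {d : ℕ} (c : Composition d) (θ : Fin d → ℝ) : ℝ :=
  ∏ j with 2 < c.blocksFun j, blockNorm c θ j ^ (2 - (c.blocksFun j : ℤ))

/-- The (improper) blockwise Stein prior on the first `d` coordinates, the others being `0`. -/
def steinPrior {d : ℕ} (c : Composition d) : Measure (ℕ → ℝ) :=
  ((volume : Measure (Fin d → ℝ)).withDensity fun θ => ENNReal.ofReal (steinDensity c θ)).map
    (zeroExtend d)

/-- The blockwise Stein predictive distribution. As `Q_θ = ⊗_{i<d} N(θ_i, ε'²) ⊗ ⊗_{i≥d} N(0, ε'²)`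
for the `θ` that the prior charges, this is the posterior average of `⊗_{i<d} N(θ_i, ε'²)` times
`⊗_{i≥d} N(0, ε'²)`. -/
def steinPredictive (ε ε' : ℝ) {d : ℕ} (c : Composition d) : (ℕ → ℝ) → Measure (ℕ → ℝ) :=
  bayesPredictive ε ε' d (steinPrior c)

/-- `v²_ε = ε²`. -/
def vSq (ε : ℝ) : ℝ := ε ^ 2

/-- `v²_{ε,ε'} = 1 / (1/ε² + 1/ε'²)`. -/
def vSqPair (ε ε' : ℝ) : ℝ := 1 / (1 / ε ^ 2 + 1 / ε' ^ 2)

end SeqPrediction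

end

/-!
A Bayesian predictive distribution for a prior carried by the first `d` coordinates is an exponential
tilt of `⊗_{i<d} N(θ_i, ε'²) ⊗ ⊗_{i≥d} N(0, ε'²)`. The precision-weighted mean of the current and the
future observation is sufficient and is itself an observation of `θ`, with noise variance
`v = vSqPair ε ε'` instead of `w = ε²`. Hence the logarithm of the predictive density is a difference
of log marginal densities at the two noise levels, up to an explicit Gaussian term
(`bayesPredictive_eq_tilted`), and the risk is the contribution of the coordinates beyond `d`, which
all the distributions considered share, plus
`d / 2 * log (w / v) + E_w[ℓ] - E_v[ℓ]`, where `E_s[ℓ]` is the expected log marginal density of the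
prior at noise variance `s` (`risk_bayesPredictive`).

For a Gaussian prior with scales `τ` this is
`∑_{i<d} (θ_i² * biasCoeff v w (τ_i²) + varianceTerm v w (τ_i²))` (`regret_gaussianPrior`).

For the Stein prior on a block of size `b > 2` the marginal density is, up to scaling, a function of
the squared norm of the observation: writing `‖θ‖ ^ (2 - b)` as a mixture of Gaussian densities over
the precision turns it into the Laplace transform of `y ^ (b / 2 - 2) dy` on `(0, 1)`
(`lintegral_zpow_norm_gaussian`). The derivatives of its logarithm are cumulants of a tilted law on
`(0, 1)`, which together with an integration by parts gives all the bounds on the shrinkage factor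
that are needed (`shrinkageProfile_steinLog`). As a function of the signal-to-noise ratio `a`, the
expected log marginal density has the derivative `-meanCorrection`. A reflection of the noise bounds
it by the mean shrinkage factor, Stein's identity bounds it by `b - 2` times one minus that factor,
and eliminating the factor leaves the derivative of `(b - 2) / 2 * log (b - 2 + a² * ‖θ‖²)`
(`ShrinkageProfile.integral_sub_le`). This logarithmic bound is at most the risk of any Gaussian prior
with a common variance on the block (`log_sub_log_le`). So the Stein prior is within
`log (w / v)` per block of every Gaussian prior that is constant on the blocks; blocks of size at most
`2` obey the same bound trivially (`regret_steinPrior_le`).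

Finally, given monotone scales, use on each block its largest scale. `biasCoeff` decreases in the
variance, so the bias does not grow. `varianceTerm` increases, so the variance part of a block is
controlled by that of the preceding block, whose scales are larger, up to the ratio `1 + η` of the
sizes; the first block has no predecessor and contributes at most `b₁ / 2 * log (w / v)`
(`regret_blockwise_le_regret_monotone`).
-/

noncomputable section

namespace SeqPrediction

/-! ### Products of probability measures -/

lemma lintegral_prod_infinitePi {ι : Type*} {X : ι → Type*} [∀ i, MeasurableSpace (X i)]
    (μ : ∀ i, Measure (X i)) [∀ i, IsProbabilityMeasure (μ i)] (s : Finset ι)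
    {f : ∀ i, X i → ℝ≥0∞} (hf : ∀ i, Measurable (f i)) :
    ∫⁻ x, ∏ i ∈ s, f i (x i) ∂(Measure.infinitePi μ) = ∏ i ∈ s, ∫⁻ y, f i y ∂(μ i) := by
  rw [lintegral_prod_eq_prod_lintegral_of_indepFun s (fun i (x : ∀ i, X i) => f i (x i))
    (iIndepFun_infinitePi hf) (fun i => (hf i).comp (measurable_pi_apply i))]
  refine Finset.prod_congr rfl fun i _ => ?_
  rw [← Measure.infinitePi_map_eval μ i, lintegral_map (hf i) (measurable_pi_apply i)]

lemma lintegral_prod_pi {ι : Type*} [Fintype ι] {X : ι → Type*} [∀ i, MeasurableSpace (X i)]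
    (μ : ∀ i, Measure (X i)) [∀ i, IsProbabilityMeasure (μ i)]
    {f : ∀ i, X i → ℝ≥0∞} (hf : ∀ i, Measurable (f i)) :
    ∫⁻ x, ∏ i, f i (x i) ∂(Measure.pi μ) = ∏ i, ∫⁻ y, f i y ∂(μ i) := by
  rw [← Measure.infinitePi_eq_pi, lintegral_prod_infinitePi μ _ hf]

/-- Applying the same coordinatewise operation to two independent product samples gives again a
product law. -/
lemma map_prod_infinitePi {μ ν ρ : ℕ → Measure ℝ} [∀ i, IsProbabilityMeasure (μ i)]
    [∀ i, IsProbabilityMeasure (ν i)] [∀ i, IsProbabilityMeasure (ρ i)] {w : ℝ × ℝ → ℝ}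
    (hw : Measurable w) (h : ∀ i, ((μ i).prod (ν i)).map w = ρ i) :
    ((Measure.infinitePi μ).prod (Measure.infinitePi ν)).map
      (fun p i => w (p.1 i, p.2 i)) = Measure.infinitePi ρ := by
  refine Measure.eq_infinitePi _ fun s t ht => ?_
  have hm : Measurable fun (p : (ℕ → ℝ) × (ℕ → ℝ)) i => w (p.1 i, p.2 i) := by fun_prop
  have hst : MeasurableSet (Set.pi (s : Set ℕ) t) := .pi s.countable_toSet fun i _ => ht i
  rw [Measure.map_apply hm hst, Measure.prod_apply (hm hst)]
  have h1 : ∀ x : ℕ → ℝ, (Measure.infinitePi ν) (Prod.mk x ⁻¹'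
      ((fun (p : (ℕ → ℝ) × (ℕ → ℝ)) i => w (p.1 i, p.2 i)) ⁻¹' (Set.pi (s : Set ℕ) t))) =
      ∏ i ∈ s, ν i ((fun y => w (x i, y)) ⁻¹' t i) := by
    intro x
    rw [← Measure.infinitePi_pi ν (t := fun i => (fun y => w (x i, y)) ⁻¹' t i)
      (fun i _ => (hw.comp measurable_prodMk_left) (ht i))]
    rfl
  simp_rw [h1]
  rw [lintegral_prod_infinitePi μ s (f := fun i x => ν i ((fun y => w (x, y)) ⁻¹' t i))
    (fun i => measurable_measure_prodMk_left (hw (ht i)))]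
  refine Finset.prod_congr rfl fun i _ => ?_
  rw [← h i, Measure.map_apply hw (ht i), Measure.prod_apply (hw (ht i))]
  rfl

/-! ### Gaussian densities -/

lemma gaussianPDFReal_comm (a : ℝ) (s : ℝ≥0) (x : ℝ) :
    gaussianPDFReal a s x = gaussianPDFReal x s a := by
  simp only [gaussianPDFReal]
  rw [show (x - a) ^ 2 = (a - x) ^ 2 by ring]

/-- Completing the square: two observations of `a` are the precision-weighted mean of the
observations, which is sufficient for `a`, together with their difference. -/
lemma gaussianPDFReal_mul_gaussianPDFReal {s t : ℝ≥0} (hs : s ≠ 0) (ht : t ≠ 0) (a x y : ℝ) :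
    gaussianPDFReal a s x * gaussianPDFReal a t y =
      gaussianPDFReal a (s * t / (s + t)) ((t * x + s * y) / (s + t)) *
        gaussianPDFReal x (s + t) y := by
  have hs' : (0 : ℝ) < s := by positivity
  have ht' : (0 : ℝ) < t := by positivity
  simp only [gaussianPDFReal]
  rw [mul_mul_mul_comm, ← Real.exp_add, mul_mul_mul_comm (√(2 * Real.pi * ↑(s * t / (s + t))))⁻¹,
    ← Real.exp_add, ← mul_inv, ← mul_inv,
    ← Real.sqrt_mul (by positivity), ← Real.sqrt_mul (by positivity)]
  push_cast
  congr 2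
  · congr 1
    field_simp
  · field_simp
    ring

lemma gaussianPDF_mul_gaussianPDF {s t : ℝ≥0} (hs : s ≠ 0) (ht : t ≠ 0) (a x y : ℝ) :
    gaussianPDF a s x * gaussianPDF a t y =
      gaussianPDF a (s * t / (s + t)) ((t * x + s * y) / (s + t)) *
        gaussianPDF x (s + t) y := by
  simp only [gaussianPDF]
  rw [← ENNReal.ofReal_mul (gaussianPDFReal_nonneg _ _ _),
    ← ENNReal.ofReal_mul (gaussianPDFReal_nonneg _ _ _), gaussianPDFReal_mul_gaussianPDFReal hs ht]

lemma log_gaussianPDFReal (a : ℝ) {s : ℝ≥0} (hs : s ≠ 0) (x : ℝ) :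
    Real.log (gaussianPDFReal a s x) =
      -(Real.log (2 * Real.pi * s) / 2) - (x - a) ^ 2 / (2 * s) := by
  have hs' : (0 : ℝ) < s := by positivity
  rw [gaussianPDFReal, Real.log_mul (by positivity) (Real.exp_pos _).ne', Real.log_exp,
    Real.log_inv, Real.log_sqrt (by positivity)]
  ring

/-- The marginal density of an observation with a Gaussian prior (a point mass if `t = 0`). -/
lemma lintegral_gaussianPDF_gaussianReal {s : ℝ≥0} (hs : s ≠ 0) (m : ℝ) (t : ℝ≥0) (z : ℝ) :
    ∫⁻ a, gaussianPDF a s z ∂(gaussianReal m t) = gaussianPDF m (s + t) z := by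
  by_cases ht : t = 0
  · have hm : Measurable fun a => gaussianPDF a s z := by fun_prop
    rw [ht, gaussianReal_zero_var, lintegral_dirac' _ hm, add_zero]
  · have h1 : ∀ a, gaussianPDF m t a * gaussianPDF a s z =
        gaussianPDF ((t * z + s * m) / (s + t)) (s * t / (s + t)) a * gaussianPDF m (s + t) z := by
      intro a
      have h := gaussianPDF_mul_gaussianPDF hs ht a z m
      simp only [gaussianPDF] at h ⊢
      rw [gaussianPDFReal_comm m t a, mul_comm, h, gaussianPDFReal_comm a,
        gaussianPDFReal_comm z]
    rw [gaussianReal_of_var_ne_zero _ ht,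
      lintegral_withDensity_eq_lintegral_mul _ (measurable_gaussianPDF _ _) (by fun_prop)]
    simp only [Pi.mul_apply]
    simp_rw [h1]
    rw [lintegral_mul_const _ (measurable_gaussianPDF _ _),
      lintegral_gaussianPDF_eq_one _ (by positivity), one_mul]

lemma integrable_sq_sub_gaussianReal (m c : ℝ) (v : ℝ≥0) :
    Integrable (fun x => (x - c) ^ 2) (gaussianReal m v) := by
  have h : MemLp (fun x => x - c) 2 (gaussianReal m v) :=
    (memLp_id_gaussianReal' 2 (by simp)).sub (memLp_const c)
  exact h.integrable_sq

lemma integral_sq_sub_gaussianReal (m c : ℝ) (v : ℝ≥0) :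
    ∫ x, (x - c) ^ 2 ∂(gaussianReal m v) = v + (m - c) ^ 2 := by
  have hid : Integrable (fun x : ℝ => x) (gaussianReal m v) :=
    (memLp_id_gaussianReal' 1 (by simp)).integrable le_rfl
  have h1 : ∫ x, (x - m) ^ 2 ∂(gaussianReal m v) = v := by
    have h := variance_fun_id_gaussianReal (μ := m) (v := v)
    rw [variance_eq_integral (by fun_prop)] at h
    simpa using h
  have h2 : ∀ x : ℝ, (x - c) ^ 2 = (x - m) ^ 2 + (2 * (m - c) * x + (c ^ 2 - m ^ 2)) := by
    intro x; ring
  simp_rw [h2]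
  have hl : Integrable (fun x : ℝ => 2 * (m - c) * x) (gaussianReal m v) := hid.const_mul _
  have h3 : Integrable (fun x : ℝ => 2 * (m - c) * x + (c ^ 2 - m ^ 2)) (gaussianReal m v) :=
    hl.add (integrable_const _)
  rw [integral_add (integrable_sq_sub_gaussianReal m m v) h3, integral_add hl
    (integrable_const _), integral_const_mul, h1, integral_id_gaussianReal]
  simp

/-! ### The laws of the sequence model -/

instance (σ : ℝ) (θ : ℕ → ℝ) : IsProbabilityMeasure (seqLaw σ θ) := by
  unfold seqLaw; infer_instance

instance (τ : ℕ → ℝ) : IsProbabilityMeasure (gaussianPrior τ) := by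
  unfold gaussianPrior; infer_instance

lemma seqLaw_map_eval (σ : ℝ) (θ : ℕ → ℝ) (i : ℕ) :
    (seqLaw σ θ).map (fun x => x i) = gaussianReal (θ i) (σ ^ 2).toNNReal := by
  unfold seqLaw
  exact Measure.infinitePi_map_eval (fun i => gaussianReal (θ i) (σ ^ 2).toNNReal) i

/-- Laws whose means differ only in the first `d` coordinates are mutually absolutely continuous,
with the finite likelihood ratio as density. -/
lemma seqLaw_eq_withDensity {σ : ℝ} (hσ : 0 < σ) (d : ℕ) {θ θ' : ℕ → ℝ}
    (h : ∀ i, d ≤ i → θ' i = θ i) :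
    seqLaw σ θ' = (seqLaw σ θ).withDensity fun y => ∏ i ∈ Finset.range d,
      (gaussianPDF (θ' i) (σ ^ 2).toNNReal (y i) / gaussianPDF (θ i) (σ ^ 2).toNNReal (y i)) := by
  classical
  have hv : (σ ^ 2).toNNReal ≠ 0 := by
    simpa using hσ.ne'
  symm
  refine Measure.eq_infinitePi _ fun s t ht => ?_
  have hst : MeasurableSet (Set.pi (s : Set ℕ) t) := .pi s.countable_toSet fun i _ => ht i
  rw [withDensity_apply _ hst, ← lintegral_indicator hst]
  let f : ℕ → ℝ → ℝ≥0∞ := fun i y => (if i ∈ s then (t i).indicator 1 y else 1) *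
    (if i ∈ Finset.range d then gaussianPDF (θ' i) (σ ^ 2).toNNReal y /
      gaussianPDF (θ i) (σ ^ 2).toNNReal y else 1)
  have hf : ∀ i, Measurable (f i) := by
    intro i
    have h1 : Measurable ((t i).indicator (1 : ℝ → ℝ≥0∞)) := measurable_one.indicator (ht i)
    have h2 := measurable_gaussianPDF (θ' i) (σ ^ 2).toNNReal
    have h3 := measurable_gaussianPDF (θ i) (σ ^ 2).toNNReal
    refine Measurable.mul ?_ ?_
    · split_ifs
      · exact h1
      · exact measurable_const
    · split_ifs
      · exact h2.div h3
      · exact measurable_const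
  have h1 : ∀ y : ℕ → ℝ, (Set.pi (s : Set ℕ) t).indicator (fun y => ∏ i ∈ Finset.range d,
      (gaussianPDF (θ' i) (σ ^ 2).toNNReal (y i) / gaussianPDF (θ i) (σ ^ 2).toNNReal (y i))) y =
      ∏ i ∈ s ∪ Finset.range d, f i (y i) := by
    intro y
    simp only [f]
    rw [Finset.prod_mul_distrib, Finset.prod_ite_mem, Finset.prod_ite_mem,
      Finset.inter_eq_right.2 Finset.subset_union_left,
      Finset.inter_eq_right.2 Finset.subset_union_right]
    by_cases hy : y ∈ Set.pi (s : Set ℕ) t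
    · rw [Set.indicator_of_mem hy, Finset.prod_eq_one (s := s), one_mul]
      intro i hi
      simp [Set.indicator_of_mem (hy i hi)]
    · rw [Set.indicator_of_notMem hy]
      simp only [Set.mem_pi, not_forall] at hy
      obtain ⟨i, hi, hy⟩ := hy
      rw [Finset.prod_eq_zero hi (Set.indicator_of_notMem hy _), zero_mul]
  simp_rw [h1]
  rw [seqLaw, lintegral_prod_infinitePi _ _ hf]
  have h2 : ∀ i, ∫⁻ y, f i y ∂(gaussianReal (θ i) (σ ^ 2).toNNReal) =
      if i ∈ s then gaussianReal (θ' i) (σ ^ 2).toNNReal (t i) else 1 := by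
    intro i
    have h3 : ∫⁻ y, f i y ∂(gaussianReal (θ i) (σ ^ 2).toNNReal) =
        ∫⁻ y, (if i ∈ s then (t i).indicator 1 y else 1)
          ∂(gaussianReal (θ' i) (σ ^ 2).toNNReal) := by
      by_cases hi : i ∈ Finset.range d
      · simp only [f, hi, if_true]
        have hg : Measurable fun y => (if i ∈ s then (t i).indicator (1 : ℝ → ℝ≥0∞) y else 1) := by
          split_ifs
          · exact measurable_one.indicator (ht i)
          · exact measurable_const
        rw [gaussianReal_of_var_ne_zero _ hv, gaussianReal_of_var_ne_zero _ hv,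
          lintegral_withDensity_eq_lintegral_mul _ (measurable_gaussianPDF _ _)
            (g := fun y => (if i ∈ s then (t i).indicator (1 : ℝ → ℝ≥0∞) y else 1) *
              (gaussianPDF (θ' i) (σ ^ 2).toNNReal y / gaussianPDF (θ i) (σ ^ 2).toNNReal y))
            (hg.mul ((measurable_gaussianPDF _ _).div (measurable_gaussianPDF _ _))),
          lintegral_withDensity_eq_lintegral_mul _ (measurable_gaussianPDF _ _) hg]
        refine lintegral_congr fun y => ?_
        simp only [Pi.mul_apply]
        rw [mul_left_comm, ENNReal.mul_div_cancel (gaussianPDF_pos _ hv _).ne'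
          gaussianPDF_ne_top, mul_comm]
      · simp only [f, hi, if_false, mul_one]
        rw [h i (by simpa using hi)]
    rw [h3]
    split_ifs
    · simp [lintegral_indicator (ht i)]
    · simp
  simp_rw [h2]
  rw [Finset.prod_ite_mem, Finset.inter_eq_right.2 Finset.subset_union_left]

/-- The precision-weighted mean of the current observation `x` and the future observation `y`. -/
def pooled (ε ε' : ℝ) (x y : ℕ → ℝ) : ℕ → ℝ :=
  fun i => (ε' ^ 2 * x i + ε ^ 2 * y i) / (ε ^ 2 + ε' ^ 2)

lemma measurable_pooled (ε ε' : ℝ) :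
    Measurable fun p : (ℕ → ℝ) × (ℕ → ℝ) => pooled ε ε' p.1 p.2 := by
  unfold pooled; fun_prop

/-- The precision-weighted mean of the current and the future observation is again an observation
of `θ`, with the reduced noise level `√(vSqPair ε ε')`. -/
lemma map_seqLaw_prod_seqLaw {ε ε' : ℝ} (hε : 0 < ε) (hε' : 0 < ε') (θ : ℕ → ℝ) :
    ((seqLaw ε θ).prod (seqLaw ε' θ)).map
      (fun p => pooled ε ε' p.1 p.2) =
      seqLaw (Real.sqrt (vSqPair ε ε')) θ := by
  refine map_prod_infinitePi (w := fun p => (ε' ^ 2 * p.1 + ε ^ 2 * p.2) / (ε ^ 2 + ε' ^ 2))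
    (by fun_prop) fun i => ?_
  have h1 : (fun p : ℝ × ℝ => (ε' ^ 2 * p.1 + ε ^ 2 * p.2) / (ε ^ 2 + ε' ^ 2)) =
      (fun q : ℝ × ℝ => q.1 + q.2) ∘ Prod.map (fun x => ε' ^ 2 / (ε ^ 2 + ε' ^ 2) * x)
        (fun y => ε ^ 2 / (ε ^ 2 + ε' ^ 2) * y) := by
    ext p
    simp only [Function.comp, Prod.map]
    ring
  rw [h1, ← Measure.map_map (by fun_prop) (by fun_prop),
    ← Measure.map_prod_map _ _ (by fun_prop) (by fun_prop), gaussianReal_map_const_mul,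
    gaussianReal_map_const_mul]
  change Measure.conv _ _ = _
  rw [gaussianReal_conv_gaussianReal]
  have hS : 0 < ε ^ 2 + ε' ^ 2 := by positivity
  congr 1
  · field_simp
    ring
  · have hv : 0 < vSqPair ε ε' := by unfold vSqPair; positivity
    rw [Real.sq_sqrt hv.le]
    ext
    push_cast
    rw [Real.coe_toNNReal _ (by positivity), Real.coe_toNNReal _ (by positivity),
      Real.coe_toNNReal _ hv.le, vSqPair]
    field_simp
    ring

/-! ### Kullback–Leibler divergence from a tilted measure -/

section KL
variable {α : Type*} {mα : MeasurableSpace α} {μ ν : Measure α} {f : α → ℝ}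

lemma klDiv_tilted_eq_top [IsProbabilityMeasure μ] [IsProbabilityMeasure ν]
    (hν : Integrable (fun x => Real.exp (f x)) ν) (hμ : Integrable f μ)
    (h : InformationTheory.klDiv μ ν = ∞) : InformationTheory.klDiv μ (ν.tilted f) = ∞ := by
  by_contra hne
  obtain ⟨hac, hint⟩ := InformationTheory.klDiv_ne_top_iff.1 hne
  have hac' : μ ≪ ν := hac.trans (tilted_absolutelyContinuous ν f)
  refine InformationTheory.klDiv_ne_top hac' ?_ h
  rw [integrable_congr (llr_tilted_right hac' hν)] at hint
  have h2 := hint.sub (hμ.neg.add (integrable_const (Real.log (∫ z, Real.exp (f z) ∂ν))))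
  refine h2.congr (ae_of_all _ fun x => ?_)
  simp

lemma toReal_klDiv_tilted [IsProbabilityMeasure μ] [IsProbabilityMeasure ν]
    (hν : Integrable (fun x => Real.exp (f x)) ν) (h1 : ∫ x, Real.exp (f x) ∂ν = 1)
    (hμ : Integrable f μ) (h : InformationTheory.klDiv μ ν ≠ ∞) :
    InformationTheory.klDiv μ (ν.tilted f) ≠ ∞ ∧
      (InformationTheory.klDiv μ (ν.tilted f)).toReal =
        (InformationTheory.klDiv μ ν).toReal - ∫ x, f x ∂μ := by
  obtain ⟨hac, hint⟩ := InformationTheory.klDiv_ne_top_iff.1 h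
  have hP : IsProbabilityMeasure (ν.tilted f) := isProbabilityMeasure_tilted hν
  have hac' : μ ≪ ν.tilted f := hac.trans (absolutelyContinuous_tilted hν)
  refine ⟨InformationTheory.klDiv_ne_top hac' (integrable_llr_tilted_right hac hμ hint hν), ?_⟩
  rw [InformationTheory.toReal_klDiv_of_measure_eq hac' (by simp),
    InformationTheory.toReal_klDiv_of_measure_eq hac (by simp),
    integral_llr_tilted_right hac hμ hν hint, h1]
  simp

end KL

/-! ### The Bayesian predictive distribution as a density -/

lemma toNNReal_sq_ne_zero {σ : ℝ} (hσ : 0 < σ) : (σ ^ 2).toNNReal ≠ 0 := by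
  simpa using hσ.ne'

lemma vSqPair_pos {ε ε' : ℝ} (hε : 0 < ε) (hε' : 0 < ε') : 0 < vSqPair ε ε' := by
  unfold vSqPair; positivity

lemma toNNReal_sq_sqrt_vSqPair {ε ε' : ℝ} (hε : 0 < ε) (hε' : 0 < ε') :
    ((Real.sqrt (vSqPair ε ε')) ^ 2).toNNReal =
      (ε ^ 2).toNNReal * (ε' ^ 2).toNNReal / ((ε ^ 2).toNNReal + (ε' ^ 2).toNNReal) := by
  have hv := vSqPair_pos hε hε'
  rw [Real.sq_sqrt hv.le]
  ext
  push_cast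
  simp only [Real.coe_toNNReal', max_eq_left hv.le, max_eq_left (sq_nonneg ε),
    max_eq_left (sq_nonneg ε')]
  rw [vSqPair]
  field_simp
  ring

lemma likelihood_mul_likelihood {ε ε' : ℝ} (hε : 0 < ε) (hε' : 0 < ε') (d : ℕ)
    (x y θ : ℕ → ℝ) :
    likelihood ε d x θ * ∏ i ∈ Finset.range d, gaussianPDF (θ i) (ε' ^ 2).toNNReal (y i) =
      likelihood (Real.sqrt (vSqPair ε ε')) d (pooled ε ε' x y) θ *
        ∏ i ∈ Finset.range d,
          gaussianPDF (x i) ((ε ^ 2).toNNReal + (ε' ^ 2).toNNReal) (y i) := by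
  unfold likelihood pooled
  rw [← Finset.prod_mul_distrib, ← Finset.prod_mul_distrib]
  refine Finset.prod_congr rfl fun i _ => ?_
  rw [gaussianPDF_mul_gaussianPDF (toNNReal_sq_ne_zero hε) (toNNReal_sq_ne_zero hε'),
    toNNReal_sq_sqrt_vSqPair hε hε', Real.coe_toNNReal _ (by positivity),
    Real.coe_toNNReal _ (by positivity)]

lemma measurable_likelihood (σ : ℝ) (d : ℕ) (x : ℕ → ℝ) : Measurable (likelihood σ d x) := by
  unfold likelihood; fun_prop

/-- The sequence `(θ_1, …, θ_d, 0, 0, …)` made from a sequence `θ`. -/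
def truncate (d : ℕ) (θ : ℕ → ℝ) : ℕ → ℝ := fun i => if i < d then θ i else 0

/-- The logarithm of the density of the predictive distribution at `y`, given the observation `x`,
with respect to the law of the future observation for the truncated parameter. Here `exp (ℓ₁ x)` and
`exp (ℓ₂ x)` stand for the marginal densities of the first `d` coordinates under the prior at the
noise levels `ε` and `√(vSqPair ε ε')`. -/
def logDensity (ε ε' : ℝ) (d : ℕ) (θ : ℕ → ℝ) (ℓ₁ ℓ₂ : (ℕ → ℝ) → ℝ) (x y : ℕ → ℝ) : ℝ :=
  ℓ₂ (pooled ε ε' x y) - ℓ₁ x +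
    ∑ i ∈ Finset.range d, (Real.log (gaussianPDFReal (x i)
        ((ε ^ 2).toNNReal + (ε' ^ 2).toNNReal) (y i)) -
      Real.log (gaussianPDFReal (θ i) (ε' ^ 2).toNNReal (y i)))

lemma isProbabilityMeasure_posteriorMeasure {ε : ℝ} {d : ℕ} {prior : Measure (ℕ → ℝ)}
    {ℓ₁ : (ℕ → ℝ) → ℝ} (x : ℕ → ℝ)
    (h₁ : ∫⁻ θ, likelihood ε d x θ ∂prior = ENNReal.ofReal (Real.exp (ℓ₁ x))) :
    IsProbabilityMeasure (posteriorMeasure ε d prior x) := by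
  constructor
  rw [posteriorMeasure, Measure.smul_apply, withDensity_apply _ .univ, Measure.restrict_univ, h₁,
    smul_eq_mul, ENNReal.inv_mul_cancel (by simp [Real.exp_pos]) (by simp)]

lemma measurable_prod_gaussianPDF_div (σ : ℝ) (d : ℕ) (θ : ℕ → ℝ) :
    Measurable fun p : (ℕ → ℝ) × (ℕ → ℝ) => ∏ i ∈ Finset.range d,
      (gaussianPDF (p.1 i) (σ ^ 2).toNNReal (p.2 i) /
        gaussianPDF (θ i) (σ ^ 2).toNNReal (p.2 i)) := by
  refine Finset.measurable_prod _ fun i _ => Measurable.div ?_ ?_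
  · fun_prop
  · fun_prop

section Density
variable {ε ε' : ℝ} (hε : 0 < ε) (hε' : 0 < ε') {d : ℕ} {prior : Measure (ℕ → ℝ)}
  (hprior : ∀ᵐ θ ∂prior, ∀ i, d ≤ i → θ i = 0) {ℓ₁ ℓ₂ : (ℕ → ℝ) → ℝ}
  (h₁ : ∀ x, ∫⁻ θ, likelihood ε d x θ ∂prior = ENNReal.ofReal (Real.exp (ℓ₁ x)))

include hε' hprior in
lemma ae_posterior_seqLaw_eq (θ x : ℕ → ℝ) :
    ∀ᵐ θ' ∂(posteriorMeasure ε d prior x), seqLaw ε' θ' =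
      (seqLaw ε' (truncate d θ)).withDensity fun y => ∏ i ∈ Finset.range d,
        (gaussianPDF (θ' i) (ε' ^ 2).toNNReal (y i) /
          gaussianPDF (truncate d θ i) (ε' ^ 2).toNNReal (y i)) := by
  have hac : posteriorMeasure ε d prior x ≪ prior :=
    Measure.smul_absolutelyContinuous.trans (withDensity_absolutelyContinuous _ _)
  refine hac.ae_le ?_
  filter_upwards [hprior] with θ' hθ'
  refine seqLaw_eq_withDensity hε' d fun i hi => ?_
  rw [hθ' i hi, truncate, if_neg (by omega)]

lemma measurable_withDensity_gaussianPDF_div (S : Measure (ℕ → ℝ)) [SFinite S] (θ : ℕ → ℝ) :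
    Measurable fun θ' : ℕ → ℝ => S.withDensity fun y => ∏ i ∈ Finset.range d,
        (gaussianPDF (θ' i) (ε' ^ 2).toNNReal (y i) /
          gaussianPDF (θ i) (ε' ^ 2).toNNReal (y i)) := by
  refine Measure.measurable_of_measurable_coe _ fun A hA => ?_
  simp_rw [withDensity_apply _ hA]
  exact (measurable_prod_gaussianPDF_div ε' d θ).lintegral_prod_right'

lemma prod_gaussianPDF_div_eq_exp {s t : ℝ≥0} (hs : s ≠ 0) (ht : t ≠ 0) (d : ℕ)
    (x y θ : ℕ → ℝ) :
    ∏ i ∈ Finset.range d, (gaussianPDF (x i) s (y i) / gaussianPDF (θ i) t (y i)) =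
      ENNReal.ofReal (Real.exp (∑ i ∈ Finset.range d, (Real.log (gaussianPDFReal (x i) s (y i)) -
        Real.log (gaussianPDFReal (θ i) t (y i))))) := by
  rw [Real.exp_sum, ENNReal.ofReal_prod_of_nonneg fun i _ => (Real.exp_pos _).le]
  refine Finset.prod_congr rfl fun i _ => ?_
  rw [Real.exp_sub, Real.exp_log (gaussianPDFReal_pos _ _ _ hs),
    Real.exp_log (gaussianPDFReal_pos _ _ _ ht),
    ENNReal.ofReal_div_of_pos (gaussianPDFReal_pos _ _ _ ht), gaussianPDF, gaussianPDF]

include hε hε' in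
lemma likelihood_mul_prod_div (θ x y θ' : ℕ → ℝ) :
    likelihood ε d x θ' * ∏ i ∈ Finset.range d, (gaussianPDF (θ' i) (ε' ^ 2).toNNReal (y i) /
          gaussianPDF (truncate d θ i) (ε' ^ 2).toNNReal (y i)) =
      likelihood (Real.sqrt (vSqPair ε ε')) d (pooled ε ε' x y) θ' *
        ∏ i ∈ Finset.range d,
          (gaussianPDF (x i) ((ε ^ 2).toNNReal + (ε' ^ 2).toNNReal) (y i) /
            gaussianPDF (θ i) (ε' ^ 2).toNNReal (y i)) := by
  simp only [div_eq_mul_inv]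
  rw [Finset.prod_mul_distrib, ← mul_assoc, likelihood_mul_likelihood hε hε',
    Finset.prod_mul_distrib, mul_assoc]
  congr 2
  refine Finset.prod_congr rfl fun i hi => ?_
  rw [truncate, if_pos (Finset.mem_range.1 hi)]

include hε hε' h₁ in
/-- The posterior mean of the likelihood ratio of the future observation. The product of the two
likelihoods is a likelihood of the pooled observation, so integrating out the parameter gives the
marginal density at the reduced noise level. -/
lemma lintegral_posterior_gaussianPDF_div
    (h₂ : ∀ x, ∫⁻ θ, likelihood (Real.sqrt (vSqPair ε ε')) d x θ ∂prior =
      ENNReal.ofReal (Real.exp (ℓ₂ x))) (θ x y : ℕ → ℝ) :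
    ∫⁻ θ', ∏ i ∈ Finset.range d, (gaussianPDF (θ' i) (ε' ^ 2).toNNReal (y i) /
          gaussianPDF (truncate d θ i) (ε' ^ 2).toNNReal (y i))
        ∂(posteriorMeasure ε d prior x) =
      ENNReal.ofReal (Real.exp (logDensity ε ε' d θ ℓ₁ ℓ₂ x y)) := by
  have ht := toNNReal_sq_ne_zero hε'
  have hst : (ε ^ 2).toNNReal + (ε' ^ 2).toNNReal ≠ 0 := by positivity
  have hm : Measurable fun θ' : ℕ → ℝ => ∏ i ∈ Finset.range d,
      (gaussianPDF (θ' i) (ε' ^ 2).toNNReal (y i) /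
          gaussianPDF (truncate d θ i) (ε' ^ 2).toNNReal (y i)) :=
    Finset.measurable_prod _ fun i _ => Measurable.div_const (by fun_prop) _
  rw [posteriorMeasure, lintegral_smul_measure,
    lintegral_withDensity_eq_lintegral_mul _ (measurable_likelihood ε d x) hm, h₁]
  simp only [Pi.mul_apply]
  rw [lintegral_congr (likelihood_mul_prod_div (d := d) hε hε' θ x y),
    lintegral_mul_const _ (measurable_likelihood _ _ _), h₂, smul_eq_mul,
    prod_gaussianPDF_div_eq_exp hst ht, logDensity, Real.exp_add, Real.exp_sub,
    ENNReal.ofReal_mul (by positivity),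
    ENNReal.ofReal_div_of_pos (Real.exp_pos _), ENNReal.div_eq_inv_mul, mul_assoc]

include hε hε' h₁ hprior in
lemma bayesPredictive_eq_withDensity [SFinite prior]
    (h₂ : ∀ x, ∫⁻ θ, likelihood (Real.sqrt (vSqPair ε ε')) d x θ ∂prior =
      ENNReal.ofReal (Real.exp (ℓ₂ x))) (θ x : ℕ → ℝ) :
    bayesPredictive ε ε' d prior x = (seqLaw ε' (truncate d θ)).withDensity fun y =>
      ENNReal.ofReal (Real.exp (logDensity ε ε' d θ ℓ₁ ℓ₂ x y)) := by
  have hpost := isProbabilityMeasure_posteriorMeasure x (h₁ x)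
  have hae := ae_posterior_seqLaw_eq (ε := ε) hε' hprior θ x
  have hmeas := measurable_withDensity_gaussianPDF_div (ε' := ε') (d := d)
    (seqLaw ε' (truncate d θ)) (truncate d θ)
  ext A hA
  rw [bayesPredictive, Measure.bind_apply hA ⟨_, hmeas, hae⟩, withDensity_apply _ hA,
    lintegral_congr_ae (g := fun θ' => ∫⁻ y in A, ∏ i ∈ Finset.range d,
        (gaussianPDF (θ' i) (ε' ^ 2).toNNReal (y i) /
          gaussianPDF (truncate d θ i) (ε' ^ 2).toNNReal (y i)) ∂(seqLaw ε' (truncate d θ)))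
      (hae.mono fun θ' hθ' => by simp only [hθ', withDensity_apply _ hA]),
    lintegral_lintegral_swap
      (measurable_prod_gaussianPDF_div ε' d (truncate d θ)).aemeasurable]
  simp_rw [lintegral_posterior_gaussianPDF_div hε hε' h₁ h₂]

include hε hε' h₁ hprior in
/-- The predictive distribution is a probability measure, so its density integrates to `1` and it is
an exponential tilt. -/
lemma bayesPredictive_eq_tilted [SFinite prior]
    (h₂ : ∀ x, ∫⁻ θ, likelihood (Real.sqrt (vSqPair ε ε')) d x θ ∂prior =
      ENNReal.ofReal (Real.exp (ℓ₂ x))) (θ x : ℕ → ℝ)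
    (hm : Measurable (logDensity ε ε' d θ ℓ₁ ℓ₂ x)) :
    Integrable (fun y => Real.exp (logDensity ε ε' d θ ℓ₁ ℓ₂ x y)) (seqLaw ε' (truncate d θ)) ∧
    ∫ y, Real.exp (logDensity ε ε' d θ ℓ₁ ℓ₂ x y) ∂(seqLaw ε' (truncate d θ)) = 1 ∧
    bayesPredictive ε ε' d prior x =
      (seqLaw ε' (truncate d θ)).tilted (logDensity ε ε' d θ ℓ₁ ℓ₂ x) := by
  have hpost := isProbabilityMeasure_posteriorMeasure x (h₁ x)
  have hae := ae_posterior_seqLaw_eq (ε := ε) hε' hprior θ x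
  have hmeas := measurable_withDensity_gaussianPDF_div (ε' := ε') (d := d)
    (seqLaw ε' (truncate d θ)) (truncate d θ)
  have huniv : bayesPredictive ε ε' d prior x Set.univ = 1 := by
    rw [bayesPredictive, Measure.bind_apply .univ ⟨_, hmeas, hae⟩]
    simp
  have heq := bayesPredictive_eq_withDensity hε hε' hprior h₁ h₂ θ x
  have hl : ∫⁻ y, ENNReal.ofReal (Real.exp (logDensity ε ε' d θ ℓ₁ ℓ₂ x y))
      ∂(seqLaw ε' (truncate d θ)) = 1 := by
    rw [heq, withDensity_apply _ .univ, Measure.restrict_univ] at huniv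
    exact huniv
  have hint : Integrable (fun y => Real.exp (logDensity ε ε' d θ ℓ₁ ℓ₂ x y))
      (seqLaw ε' (truncate d θ)) := by
    refine ⟨(Real.measurable_exp.comp hm).aestronglyMeasurable, ?_⟩
    rw [hasFiniteIntegral_iff_ofReal (ae_of_all _ fun _ => (Real.exp_pos _).le), hl]
    exact ENNReal.one_lt_top
  have h1 : ∫ y, Real.exp (logDensity ε ε' d θ ℓ₁ ℓ₂ x y) ∂(seqLaw ε' (truncate d θ)) = 1 := by
    rw [integral_eq_lintegral_of_nonneg_ae (ae_of_all _ fun _ => (Real.exp_pos _).le)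
      hint.aestronglyMeasurable, hl]
    rfl
  refine ⟨hint, h1, ?_⟩
  rw [heq, Measure.tilted, h1]
  simp

end Density

/-! ### The risk of a Bayesian predictive distribution -/

lemma integral_eval_seqLaw (σ : ℝ) (θ : ℕ → ℝ) (i : ℕ) {f : ℝ → ℝ} (hf : Measurable f) :
    ∫ x, f (x i) ∂(seqLaw σ θ) = ∫ x, f x ∂(gaussianReal (θ i) (σ ^ 2).toNNReal) := by
  rw [← seqLaw_map_eval, integral_map (measurable_pi_apply i).aemeasurable
    hf.aestronglyMeasurable]

lemma integrable_eval_seqLaw {σ : ℝ} {θ : ℕ → ℝ} {i : ℕ} {f : ℝ → ℝ} (hf : Measurable f)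
    (h : Integrable f (gaussianReal (θ i) (σ ^ 2).toNNReal)) :
    Integrable (fun x => f (x i)) (seqLaw σ θ) := by
  rw [← seqLaw_map_eval] at h
  exact (integrable_map_measure hf.aestronglyMeasurable
    (measurable_pi_apply i).aemeasurable).1 h

lemma memLp_eval_seqLaw (σ : ℝ) (θ : ℕ → ℝ) (i : ℕ) :
    MemLp (fun x : ℕ → ℝ => x i) 2 (seqLaw σ θ) := by
  have h : MemLp id 2 (gaussianReal (θ i) (σ ^ 2).toNNReal) := memLp_id_gaussianReal' 2 (by simp)
  rw [← seqLaw_map_eval] at h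
  exact (memLp_map_measure_iff aestronglyMeasurable_id (measurable_pi_apply i).aemeasurable).1 h

lemma integrable_sq_sub_prod_seqLaw (ε ε' : ℝ) (θ : ℕ → ℝ) (i : ℕ) :
    Integrable (fun p : (ℕ → ℝ) × (ℕ → ℝ) => (p.2 i - p.1 i) ^ 2)
      ((seqLaw ε θ).prod (seqLaw ε' θ)) :=
  (((memLp_eval_seqLaw ε' θ i).comp_snd (seqLaw ε θ)).sub
    ((memLp_eval_seqLaw ε θ i).comp_fst (seqLaw ε' θ))).integrable_sq

lemma integral_sq_sub_prod_seqLaw (ε ε' : ℝ) (θ : ℕ → ℝ) (i : ℕ) :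
    ∫ p, (p.2 i - p.1 i) ^ 2 ∂((seqLaw ε θ).prod (seqLaw ε' θ)) = ε ^ 2 + ε' ^ 2 := by
  rw [integral_prod _ (integrable_sq_sub_prod_seqLaw ε ε' θ i)]
  have h : ∀ x : ℕ → ℝ, ∫ y, (y i - x i) ^ 2 ∂(seqLaw ε' θ) = ε' ^ 2 + (x i - θ i) ^ 2 := by
    intro x
    rw [integral_eval_seqLaw ε' θ i (f := fun y => (y - x i) ^ 2) (by fun_prop),
      integral_sq_sub_gaussianReal, Real.coe_toNNReal _ (sq_nonneg _)]
    ring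
  simp_rw [h]
  rw [integral_add (integrable_const _) (integrable_eval_seqLaw (f := fun x => (x - θ i) ^ 2)
      (by fun_prop) (integrable_sq_sub_gaussianReal _ _ _)),
    integral_eval_seqLaw ε θ i (f := fun x => (x - θ i) ^ 2) (by fun_prop),
    integral_sq_sub_gaussianReal, Real.coe_toNNReal _ (sq_nonneg _)]
  simp
  ring

lemma vSq_div_vSqPair {ε ε' : ℝ} (hε : 0 < ε) (hε' : 0 < ε') :
    vSq ε / vSqPair ε ε' = (ε ^ 2 + ε' ^ 2) / ε' ^ 2 := by
  unfold vSq vSqPair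
  field_simp
  ring

section Gain
variable {ε ε' : ℝ} (hε : 0 < ε) (hε' : 0 < ε')
include hε hε'

lemma log_gaussianPDFReal_sub (x y m : ℝ) :
    Real.log (gaussianPDFReal x ((ε ^ 2).toNNReal + (ε' ^ 2).toNNReal) y) -
      Real.log (gaussianPDFReal m (ε' ^ 2).toNNReal y) =
    -(Real.log (vSq ε / vSqPair ε ε') / 2) +
      ((y - m) ^ 2 / (2 * ε' ^ 2) - (y - x) ^ 2 / (2 * (ε ^ 2 + ε' ^ 2))) := by
  have hs := toNNReal_sq_ne_zero hε
  have ht := toNNReal_sq_ne_zero hε'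
  rw [log_gaussianPDFReal _ (by positivity), log_gaussianPDFReal _ ht, vSq_div_vSqPair hε hε',
    NNReal.coe_add, Real.coe_toNNReal _ (sq_nonneg _), Real.coe_toNNReal _ (sq_nonneg _),
    Real.log_mul (x := 2 * Real.pi) (by positivity) (by positivity),
    Real.log_mul (x := 2 * Real.pi) (by positivity) (by positivity),
    Real.log_div (by positivity) (by positivity)]
  ring

lemma integrable_log_gaussianPDFReal_sub (θ : ℕ → ℝ) (i : ℕ) :
    Integrable (fun p : (ℕ → ℝ) × (ℕ → ℝ) =>
      Real.log (gaussianPDFReal (p.1 i) ((ε ^ 2).toNNReal + (ε' ^ 2).toNNReal) (p.2 i)) -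
      Real.log (gaussianPDFReal (θ i) (ε' ^ 2).toNNReal (p.2 i)))
      ((seqLaw ε θ).prod (seqLaw ε' θ)) := by
  simp_rw [log_gaussianPDFReal_sub hε hε']
  have h1 : Integrable (fun p : (ℕ → ℝ) × (ℕ → ℝ) => (p.2 i - θ i) ^ 2)
      ((seqLaw ε θ).prod (seqLaw ε' θ)) :=
    (integrable_eval_seqLaw (f := fun x => (x - θ i) ^ 2)
      (by fun_prop) (integrable_sq_sub_gaussianReal _ _ _)).comp_snd _
  exact (integrable_const _).add ((h1.div_const _).sub
    ((integrable_sq_sub_prod_seqLaw ε ε' θ i).div_const _))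

lemma integral_log_gaussianPDFReal_sub (θ : ℕ → ℝ) (i : ℕ) :
    ∫ p, (Real.log (gaussianPDFReal (p.1 i) ((ε ^ 2).toNNReal + (ε' ^ 2).toNNReal) (p.2 i)) -
      Real.log (gaussianPDFReal (θ i) (ε' ^ 2).toNNReal (p.2 i)))
      ∂((seqLaw ε θ).prod (seqLaw ε' θ)) = -(Real.log (vSq ε / vSqPair ε ε') / 2) := by
  simp_rw [log_gaussianPDFReal_sub hε hε']
  have h0 : Integrable (fun y : ℕ → ℝ => (y i - θ i) ^ 2) (seqLaw ε' θ) :=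
    integrable_eval_seqLaw (f := fun x => (x - θ i) ^ 2)
      (by fun_prop) (integrable_sq_sub_gaussianReal _ _ _)
  have h1 : Integrable (fun p : (ℕ → ℝ) × (ℕ → ℝ) => (p.2 i - θ i) ^ 2 / (2 * ε' ^ 2))
      ((seqLaw ε θ).prod (seqLaw ε' θ)) := (h0.comp_snd _).div_const _
  have h2 : Integrable (fun p : (ℕ → ℝ) × (ℕ → ℝ) =>
      (p.2 i - p.1 i) ^ 2 / (2 * (ε ^ 2 + ε' ^ 2))) ((seqLaw ε θ).prod (seqLaw ε' θ)) :=
    (integrable_sq_sub_prod_seqLaw ε ε' θ i).div_const _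
  have h3 : ∫ p : (ℕ → ℝ) × (ℕ → ℝ), (p.2 i - θ i) ^ 2 ∂((seqLaw ε θ).prod (seqLaw ε' θ)) =
      ε' ^ 2 := by
    rw [integral_fun_snd (f := fun y : ℕ → ℝ => (y i - θ i) ^ 2),
      integral_eval_seqLaw ε' θ i (f := fun y => (y - θ i) ^ 2) (by fun_prop),
      integral_sq_sub_gaussianReal, Real.coe_toNNReal _ (sq_nonneg _)]
    simp
  have h12 : Integrable (fun p : (ℕ → ℝ) × (ℕ → ℝ) => (p.2 i - θ i) ^ 2 / (2 * ε' ^ 2) -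
      (p.2 i - p.1 i) ^ 2 / (2 * (ε ^ 2 + ε' ^ 2))) ((seqLaw ε θ).prod (seqLaw ε' θ)) :=
    h1.sub h2
  rw [integral_add (integrable_const _) h12, integral_sub h1 h2, integral_div,
    integral_div, h3, integral_sq_sub_prod_seqLaw]
  have hS : 0 < ε ^ 2 + ε' ^ 2 := by positivity
  simp
  field_simp
  ring

end Gain

section Risk
variable {ε ε' : ℝ} {d : ℕ} {prior : Measure (ℕ → ℝ)} {ℓ₁ ℓ₂ : (ℕ → ℝ) → ℝ}

lemma measurable_logDensity (θ : ℕ → ℝ) (hm₁ : Measurable ℓ₁) (hm₂ : Measurable ℓ₂) :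
    Measurable fun p : (ℕ → ℝ) × (ℕ → ℝ) => logDensity ε ε' d θ ℓ₁ ℓ₂ p.1 p.2 := by
  have h := hm₂.comp (measurable_pooled ε ε')
  unfold logDensity
  refine (h.sub (hm₁.comp measurable_fst)).add (Finset.measurable_sum _ fun i _ => ?_)
  exact (Real.measurable_log.comp (by fun_prop)).sub (Real.measurable_log.comp (by fun_prop))

lemma integrable_logDensity (hε : 0 < ε) (hε' : 0 < ε') (θ : ℕ → ℝ) (hm₂ : Measurable ℓ₂)
    (hi₁ : Integrable ℓ₁ (seqLaw ε θ))
    (hi₂ : Integrable ℓ₂ (seqLaw (Real.sqrt (vSqPair ε ε')) θ)) :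
    Integrable (fun p : (ℕ → ℝ) × (ℕ → ℝ) => logDensity ε ε' d θ ℓ₁ ℓ₂ p.1 p.2)
      ((seqLaw ε θ).prod (seqLaw ε' θ)) := by
  rw [← map_seqLaw_prod_seqLaw hε hε'] at hi₂
  have h2 := (integrable_map_measure hm₂.aestronglyMeasurable
    (measurable_pooled ε ε').aemeasurable).1 hi₂
  exact (h2.sub (hi₁.comp_fst _)).add
    (integrable_finsetSum _ fun i _ => integrable_log_gaussianPDFReal_sub hε hε' θ i)

lemma integral_logDensity (hε : 0 < ε) (hε' : 0 < ε') (θ : ℕ → ℝ) (hm₂ : Measurable ℓ₂)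
    (hi₁ : Integrable ℓ₁ (seqLaw ε θ))
    (hi₂ : Integrable ℓ₂ (seqLaw (Real.sqrt (vSqPair ε ε')) θ)) :
    ∫ p, logDensity ε ε' d θ ℓ₁ ℓ₂ p.1 p.2 ∂((seqLaw ε θ).prod (seqLaw ε' θ)) =
      ∫ x, ℓ₂ x ∂(seqLaw (Real.sqrt (vSqPair ε ε')) θ) - ∫ x, ℓ₁ x ∂(seqLaw ε θ) -
        d / 2 * Real.log (vSq ε / vSqPair ε ε') := by
  rw [← map_seqLaw_prod_seqLaw hε hε'] at hi₂ ⊢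
  have h2 : Integrable (fun p : (ℕ → ℝ) × (ℕ → ℝ) => ℓ₂ (pooled ε ε' p.1 p.2))
      ((seqLaw ε θ).prod (seqLaw ε' θ)) := (integrable_map_measure hm₂.aestronglyMeasurable
    (measurable_pooled ε ε').aemeasurable).1 hi₂
  have h1 : Integrable (fun p : (ℕ → ℝ) × (ℕ → ℝ) => ℓ₁ p.1)
      ((seqLaw ε θ).prod (seqLaw ε' θ)) := hi₁.comp_fst _
  have h21 : Integrable (fun p : (ℕ → ℝ) × (ℕ → ℝ) => ℓ₂ (pooled ε ε' p.1 p.2) - ℓ₁ p.1)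
      ((seqLaw ε θ).prod (seqLaw ε' θ)) := h2.sub h1
  unfold logDensity
  rw [integral_add h21
    (integrable_finsetSum _ fun i _ => integrable_log_gaussianPDFReal_sub hε hε' θ i),
    integral_sub h2 h1,
    integral_finsetSum _ fun i _ => integrable_log_gaussianPDFReal_sub hε hε' θ i,
    integral_fun_fst (f := ℓ₁)]
  simp_rw [integral_log_gaussianPDFReal_sub hε hε']
  rw [integral_map (measurable_pooled ε ε').aemeasurable hm₂.aestronglyMeasurable]
  simp only [Finset.sum_const, Finset.card_range, nsmul_eq_mul, probReal_univ, one_smul]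
  ring

/-- The divergence between the true law of the future observation and the law obtained by replacing
the coordinates of `θ` beyond the first `d` by `0`: every predictive distribution considered here
pays this amount. -/
def tailDiv (ε' : ℝ) (d : ℕ) (θ : ℕ → ℝ) : ℝ≥0∞ :=
  InformationTheory.klDiv (seqLaw ε' θ) (seqLaw ε' (truncate d θ))

variable [SFinite prior] (hε : 0 < ε) (hε' : 0 < ε')
  (hprior : ∀ᵐ θ ∂prior, ∀ i, d ≤ i → θ i = 0)
  (h₁ : ∀ x, ∫⁻ θ, likelihood ε d x θ ∂prior = ENNReal.ofReal (Real.exp (ℓ₁ x)))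
  (h₂ : ∀ x, ∫⁻ θ, likelihood (Real.sqrt (vSqPair ε ε')) d x θ ∂prior =
      ENNReal.ofReal (Real.exp (ℓ₂ x)))
  (hm₁ : Measurable ℓ₁) (hm₂ : Measurable ℓ₂) {θ : ℕ → ℝ}
  (hi₁ : Integrable ℓ₁ (seqLaw ε θ))
  (hi₂ : Integrable ℓ₂ (seqLaw (Real.sqrt (vSqPair ε ε')) θ))
include hε hε' hprior h₁ h₂ hm₁ hm₂ hi₁ hi₂

lemma risk_bayesPredictive_eq_top (hK : tailDiv ε' d θ = ∞) :
    risk ε ε' θ (bayesPredictive ε ε' d prior) = ∞ := by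
  have hG := measurable_logDensity (ε := ε) (ε' := ε') (d := d) θ hm₁ hm₂
  have hGi := integrable_logDensity (d := d) hε hε' θ hm₂ hi₁ hi₂
  have h : ∀ᵐ x ∂(seqLaw ε θ), InformationTheory.klDiv (seqLaw ε' θ)
      (bayesPredictive ε ε' d prior x) = ∞ := by
    filter_upwards [hGi.prod_right_ae] with x hx
    obtain ⟨hint, h1, heq⟩ := bayesPredictive_eq_tilted hε hε' hprior h₁ h₂ θ x
      (hG.comp measurable_prodMk_left)
    rw [heq]
    exact klDiv_tilted_eq_top hint hx hK
  rw [risk, lintegral_congr_ae h]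
  simp

/-- The risk in terms of the expected logarithms of the marginal densities of the observation at the
two noise levels. -/
lemma risk_bayesPredictive (hK : tailDiv ε' d θ ≠ ∞) :
    risk ε ε' θ (bayesPredictive ε ε' d prior) = ENNReal.ofReal ((tailDiv ε' d θ).toReal +
      (d / 2 * Real.log (vSq ε / vSqPair ε ε') + ∫ x, ℓ₁ x ∂(seqLaw ε θ) -
        ∫ x, ℓ₂ x ∂(seqLaw (Real.sqrt (vSqPair ε ε')) θ))) := by
  have hG := measurable_logDensity (ε := ε) (ε' := ε') (d := d) θ hm₁ hm₂
  have hGi := integrable_logDensity (d := d) hε hε' θ hm₂ hi₁ hi₂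
  have h : ∀ᵐ x ∂(seqLaw ε θ), InformationTheory.klDiv (seqLaw ε' θ)
      (bayesPredictive ε ε' d prior x) = ENNReal.ofReal ((tailDiv ε' d θ).toReal -
        ∫ y, logDensity ε ε' d θ ℓ₁ ℓ₂ x y ∂(seqLaw ε' θ)) ∧
      0 ≤ (tailDiv ε' d θ).toReal - ∫ y, logDensity ε ε' d θ ℓ₁ ℓ₂ x y ∂(seqLaw ε' θ) := by
    filter_upwards [hGi.prod_right_ae] with x hx
    obtain ⟨hint, h1, heq⟩ := bayesPredictive_eq_tilted hε hε' hprior h₁ h₂ θ x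
      (hG.comp measurable_prodMk_left)
    obtain ⟨hne, hr⟩ := toReal_klDiv_tilted hint h1 hx hK
    rw [heq, tailDiv, ← hr, ENNReal.ofReal_toReal hne]
    exact ⟨rfl, ENNReal.toReal_nonneg⟩
  have hI : Integrable (fun x => ∫ y, logDensity ε ε' d θ ℓ₁ ℓ₂ x y ∂(seqLaw ε' θ))
      (seqLaw ε θ) := hGi.integral_prod_left
  have hI' : Integrable (fun x => (tailDiv ε' d θ).toReal -
      ∫ y, logDensity ε ε' d θ ℓ₁ ℓ₂ x y ∂(seqLaw ε' θ)) (seqLaw ε θ) :=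
    (integrable_const _).sub hI
  rw [risk, lintegral_congr_ae (h.mono fun x hx => hx.1),
    ← ofReal_integral_eq_lintegral_ofReal hI'
      (h.mono fun x hx => hx.2), integral_sub (integrable_const _) hI,
    ← integral_prod (fun p : (ℕ → ℝ) × (ℕ → ℝ) => logDensity ε ε' d θ ℓ₁ ℓ₂ p.1 p.2) hGi,
    integral_logDensity hε hε' θ hm₂ hi₁ hi₂]
  congr 1
  simp
  ring

end Risk

/-! ### Stein's identity -/

section Stein
variable {ι : Type*} [Fintype ι]

lemma pi_gaussianReal_eq_withDensity (m : ι → ℝ) {s : ℝ≥0} (hs : s ≠ 0) :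
    Measure.pi (fun i => gaussianReal (m i) s) =
      (volume : Measure (ι → ℝ)).withDensity fun x => ∏ i, gaussianPDF (m i) s (x i) := by
  classical
  refine Measure.pi_eq fun t ht => ?_
  have hst : MeasurableSet (Set.univ.pi t) := .univ_pi ht
  rw [withDensity_apply _ hst, ← lintegral_indicator hst]
  have h1 : ∀ x : ι → ℝ, (Set.univ.pi t).indicator (fun x => ∏ i, gaussianPDF (m i) s (x i)) x =
      ENNReal.ofReal (∏ i, (t i).indicator (gaussianPDFReal (m i) s) (x i)) := by
    intro x
    by_cases hx : x ∈ Set.univ.pi t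
    · rw [Set.indicator_of_mem hx,
        Finset.prod_congr rfl fun i hi => Set.indicator_of_mem (hx i (Set.mem_univ i)) _,
        ENNReal.ofReal_prod_of_nonneg fun i _ => gaussianPDFReal_nonneg _ _ _]
      rfl
    · rw [Set.indicator_of_notMem hx]
      simp only [Set.mem_pi, not_forall] at hx
      obtain ⟨i, -, hx⟩ := hx
      rw [Finset.prod_eq_zero (Finset.mem_univ i) (Set.indicator_of_notMem hx _),
        ENNReal.ofReal_zero]
  have hi : ∀ i, Integrable ((t i).indicator (gaussianPDFReal (m i) s)) :=
    fun i => (integrable_gaussianPDFReal _ _).indicator (ht i)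
  have h0 : ∀ i x, 0 ≤ (t i).indicator (gaussianPDFReal (m i) s) x :=
    fun i x => Set.indicator_nonneg (fun _ _ => gaussianPDFReal_nonneg _ _ _) x
  have hint : Integrable (fun x : ι → ℝ => ∏ i, (t i).indicator (gaussianPDFReal (m i) s) (x i)) :=
    Integrable.fintype_prod hi
  simp_rw [h1]
  rw [← ofReal_integral_eq_lintegral_ofReal hint
    (ae_of_all _ fun x => Finset.prod_nonneg fun i _ => h0 i _),
    integral_fintype_prod_volume_eq_prod,
    ENNReal.ofReal_prod_of_nonneg fun i _ => integral_nonneg (h0 i)]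
  refine Finset.prod_congr rfl fun i _ => ?_
  rw [gaussianReal_apply_eq_integral _ hs, integral_indicator (ht i)]

/-- The standard Gaussian law on `ι → ℝ`. -/
def stdGauss (ι : Type*) [Fintype ι] : Measure (ι → ℝ) :=
  Measure.pi fun _ => gaussianReal 0 1

instance : IsProbabilityMeasure (stdGauss ι) := by
  unfold stdGauss; infer_instance

/-- The density of `stdGauss`. -/
def stdGaussPDF (x : ι → ℝ) : ℝ := ∏ i, gaussianPDFReal 0 1 (x i)

lemma stdGaussPDF_nonneg (x : ι → ℝ) : 0 ≤ stdGaussPDF x :=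
  Finset.prod_nonneg fun _ _ => gaussianPDFReal_nonneg _ _ _

lemma measurable_stdGaussPDF : Measurable (stdGaussPDF (ι := ι)) := by
  unfold stdGaussPDF; fun_prop

lemma stdGauss_eq_withDensity :
    stdGauss ι = (volume : Measure (ι → ℝ)).withDensity
      fun x => ENNReal.ofReal (stdGaussPDF x) := by
  rw [stdGauss, pi_gaussianReal_eq_withDensity _ one_ne_zero]
  congr 1
  ext x
  rw [stdGaussPDF, ENNReal.ofReal_prod_of_nonneg fun _ _ => gaussianPDFReal_nonneg _ _ _]
  rfl

lemma integrable_stdGauss_iff {g : (ι → ℝ) → ℝ} :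
    Integrable g (stdGauss ι) ↔ Integrable fun x => stdGaussPDF x * g x := by
  rw [stdGauss_eq_withDensity, integrable_withDensity_iff_integrable_smul₀'
    measurable_stdGaussPDF.ennreal_ofReal.aemeasurable (ae_of_all _ fun _ => ENNReal.ofReal_lt_top)]
  simp only [ENNReal.toReal_ofReal (stdGaussPDF_nonneg _), smul_eq_mul]

lemma integral_stdGauss (g : (ι → ℝ) → ℝ) :
    ∫ x, g x ∂(stdGauss ι) = ∫ x, stdGaussPDF x * g x := by
  rw [stdGauss_eq_withDensity, integral_withDensity_eq_integral_toReal_smul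
    measurable_stdGaussPDF.ennreal_ofReal (ae_of_all _ fun _ => ENNReal.ofReal_lt_top)]
  simp only [ENNReal.toReal_ofReal (stdGaussPDF_nonneg _), smul_eq_mul]

lemma hasLineDerivAt_stdGaussPDF [DecidableEq ι] (x : ι → ℝ) (i : ι) :
    HasLineDerivAt ℝ stdGaussPDF (-(x i) * stdGaussPDF x) x (Pi.single i 1) := by
  have h1 : ∀ y : ι → ℝ, stdGaussPDF y =
      (∏ _j : ι, (√(2 * Real.pi))⁻¹) * Real.exp (-(∑ j, y j ^ 2) / 2) := by
    intro y
    simp only [stdGaussPDF, gaussianPDFReal, Finset.prod_mul_distrib, ← Real.exp_sum]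
    simp only [NNReal.coe_one, mul_one, sub_zero]
    rw [← Finset.sum_div, Finset.sum_neg_distrib]
  have h2 : HasDerivAt (fun t : ℝ => ∑ j, (x + t • Pi.single (M := fun _ => ℝ) i 1) j ^ 2)
      (2 * x i) 0 := by
    have h3 : ∀ j, HasDerivAt (fun t : ℝ => (x + t • Pi.single (M := fun _ => ℝ) i 1) j ^ 2)
        (2 * x j * Pi.single (M := fun _ => ℝ) i 1 j) 0 := by
      intro j
      have h4 : HasDerivAt (fun t : ℝ => x j + t * Pi.single (M := fun _ => ℝ) i 1 j)
          (Pi.single (M := fun _ => ℝ) i 1 j) 0 := by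
        simpa using ((hasDerivAt_id (0 : ℝ)).mul_const
          (Pi.single (M := fun _ => ℝ) i 1 j)).const_add (x j)
      simpa using h4.fun_pow 2
    have h5 := HasDerivAt.fun_sum (u := Finset.univ) fun j _ => h3 j
    simpa [Pi.single_apply] using h5
  rw [show stdGaussPDF = _ from funext h1]
  unfold HasLineDerivAt
  have h6 := ((h2.neg.div_const 2).exp).const_mul (∏ _j : ι, (√(2 * Real.pi))⁻¹)
  refine h6.congr_deriv ?_
  simp
  ring

/-- Integration by parts against the Gaussian density. -/
lemma integral_coord_mul_stdGauss [DecidableEq ι] (i : ι) {g g' : (ι → ℝ) → ℝ}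
    (hg : Integrable g (stdGauss ι)) (hig : Integrable (fun x => x i * g x) (stdGauss ι))
    (hg' : Integrable g' (stdGauss ι))
    (hd : ∀ x, HasLineDerivAt ℝ g (g' x) x (Pi.single i 1)) :
    ∫ x, x i * g x ∂(stdGauss ι) = ∫ x, g' x ∂(stdGauss ι) := by
  rw [integrable_stdGauss_iff] at hg hig hg'
  have h := integral_bilinear_hasLineDerivAt_right_eq_neg_left_of_integrable
    (μ := (volume : Measure (ι → ℝ))) (f := stdGaussPDF) (f' := fun x => -(x i) * stdGaussPDF x)
    (g := g) (g' := g') (v := Pi.single i 1) (B := ContinuousLinearMap.mul ℝ ℝ)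
    (by
      refine hig.neg.congr (ae_of_all _ fun x => ?_)
      simp
      ring) (by simpa using hg') (by simpa using hg)
    (fun x _ => hasLineDerivAt_stdGaussPDF x i) (fun x _ => hd x)
  rw [integral_stdGauss, integral_stdGauss]
  simp only [ContinuousLinearMap.mul_apply'] at h
  rw [h, ← integral_neg]
  refine integral_congr_ae (ae_of_all _ fun x => ?_)
  simp
  ring

lemma memLp_eval_stdGauss (i : ι) : MemLp (fun x : ι → ℝ => x i) 2 (stdGauss ι) := by
  have h : MemLp id 2 (gaussianReal 0 1) := memLp_id_gaussianReal' 2 (by simp)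
  have hmp := measurePreserving_eval (fun _ : ι => gaussianReal 0 1) i
  exact h.comp_measurePreserving hmp

lemma stdGauss_map_neg : (stdGauss ι).map (fun x => -x) = stdGauss ι := by
  have h := Measure.pi_map_pi (μ := fun _ : ι => gaussianReal 0 1) (f := fun _ x => -x)
    (fun _ => by fun_prop)
  simp only [gaussianReal_map_neg, neg_zero] at h
  exact h

end Stein

/-! ### Radial functions of a shifted Gaussian vector -/

/-- The squared norm of the Gaussian vector with mean `a • θ` whose noise is `x`. -/
def shiftSq {ι : Type*} [Fintype ι] (θ : ι → ℝ) (a : ℝ) (x : ι → ℝ) : ℝ :=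
  ∑ i, (a * θ i + x i) ^ 2

/-- What the argument uses about the logarithm `f` of the marginal density of the Stein prior, as
a function of the squared norm: `κ = -2 f'` is the factor by which the posterior mean shrinks the
observation, `κ'` is its derivative, and `n` is the dimension minus two. -/
structure ShrinkageProfile (n : ℝ) (f κ κ' : ℝ → ℝ) : Prop where
  hasDerivAt : ∀ r, HasDerivAt f (-κ r / 2) r
  hasDerivAt_shrink : ∀ r, HasDerivAt κ (κ' r) r
  nonneg : ∀ r, 0 ≤ κ r
  le_one : ∀ r, κ r ≤ 1
  deriv_nonpos : ∀ r, κ' r ≤ 0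
  neg_one_le_deriv : ∀ r, -1 ≤ κ' r
  mul_le : ∀ r, 0 ≤ r → r * κ r ≤ n
  deriv_mul_nonneg : ∀ r, 0 ≤ r → 0 ≤ κ r + r * κ' r

section Radial
variable {ι : Type*} [Fintype ι] {n : ℝ} {f κ κ' : ℝ → ℝ} (h : ShrinkageProfile n f κ κ')
  (θ : ι → ℝ)

lemma shiftSq_nonneg (a : ℝ) (x : ι → ℝ) : 0 ≤ shiftSq θ a x :=
  Finset.sum_nonneg fun _ _ => sq_nonneg _

lemma measurable_shiftSq (a : ℝ) : Measurable (shiftSq θ a) := by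
  unfold shiftSq; fun_prop

include h

lemma ShrinkageProfile.continuous : Continuous f :=
  continuous_iff_continuousAt.2 fun r => (h.hasDerivAt r).continuousAt

lemma ShrinkageProfile.continuous_shrink : Continuous κ :=
  continuous_iff_continuousAt.2 fun r => (h.hasDerivAt_shrink r).continuousAt

lemma ShrinkageProfile.measurable_deriv : Measurable κ' := by
  rw [show κ' = deriv κ from funext fun r => (h.hasDerivAt_shrink r).deriv.symm]
  exact _root_.measurable_deriv κ

lemma ShrinkageProfile.antitone : Antitone κ :=
  antitone_of_hasDerivAt_nonpos (fun r => h.hasDerivAt_shrink r) fun r => h.deriv_nonpos r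

lemma ShrinkageProfile.abs_apply_le (r : ℝ) : |f r| ≤ |f 0| + |r| := by
  have hl : LipschitzWith 1 f := by
    refine lipschitzWith_of_nnnorm_deriv_le (fun r => (h.hasDerivAt r).differentiableAt) fun r => ?_
    rw [(h.hasDerivAt r).deriv, ← NNReal.coe_le_coe, coe_nnnorm, Real.norm_eq_abs, abs_le]
    have := h.nonneg r
    have := h.le_one r
    constructor <;> push_cast <;> linarith
  have h2 := hl.dist_le_mul r 0
  rw [Real.dist_eq, Real.dist_eq, sub_zero, NNReal.coe_one, one_mul] at h2
  have := abs_sub_abs_le_abs_sub (f r) (f 0)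
  linarith

omit h in
lemma memLp_shift (a : ℝ) (i : ι) : MemLp (fun x : ι → ℝ => a * θ i + x i) 2 (stdGauss ι) := by
  have h1 : MemLp (fun _ : ι → ℝ => a * θ i) 2 (stdGauss ι) := memLp_const _
  exact h1.add (memLp_eval_stdGauss i)

omit h in
lemma integrable_shiftSq (a : ℝ) : Integrable (shiftSq θ a) (stdGauss ι) :=
  integrable_finsetSum _ fun i _ => (memLp_shift θ a i).integrable_sq

lemma ShrinkageProfile.integrable_comp_shiftSq (a : ℝ) :
    Integrable (fun x => f (shiftSq θ a x)) (stdGauss ι) := by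
  refine ((integrable_const |f 0|).add (integrable_shiftSq θ a).abs).mono'
    (h.continuous.measurable.comp (measurable_shiftSq θ a)).aestronglyMeasurable
    (ae_of_all _ fun x => ?_)
  rw [Real.norm_eq_abs]
  exact h.abs_apply_le _

lemma ShrinkageProfile.integrable_shrink_mul (a : ℝ) {g : (ι → ℝ) → ℝ}
    (hg : Integrable g (stdGauss ι)) :
    Integrable (fun x => κ (shiftSq θ a x) * g x) (stdGauss ι) := by
  refine hg.bdd_mul (c := 1)
    (h.continuous_shrink.measurable.comp (measurable_shiftSq θ a)).aestronglyMeasurable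
    (ae_of_all _ fun x => ?_)
  rw [Real.norm_eq_abs, abs_of_nonneg (h.nonneg _)]
  exact h.le_one _

lemma ShrinkageProfile.integrable_shrink (a : ℝ) :
    Integrable (fun x => κ (shiftSq θ a x)) (stdGauss ι) := by
  simpa using h.integrable_shrink_mul θ a (integrable_const (1 : ℝ))

lemma ShrinkageProfile.integrable_deriv_mul (a : ℝ) {g : (ι → ℝ) → ℝ}
    (hg : Integrable g (stdGauss ι)) :
    Integrable (fun x => κ' (shiftSq θ a x) * g x) (stdGauss ι) := by
  refine hg.bdd_mul (c := 1)
    (h.measurable_deriv.comp (measurable_shiftSq θ a)).aestronglyMeasurable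
    (ae_of_all _ fun x => ?_)
  rw [Real.norm_eq_abs, abs_le]
  exact ⟨h.neg_one_le_deriv _, (h.deriv_nonpos _).trans zero_le_one⟩

/-- The expected inner product of `θ` with the shrinkage correction. -/
def meanCorrection {ι : Type*} [Fintype ι] (κ : ℝ → ℝ) (θ : ι → ℝ) (a : ℝ) : ℝ :=
  ∫ x, κ (shiftSq θ a x) * ∑ i, θ i * (a * θ i + x i) ∂(stdGauss ι)

omit h in
lemma integrable_inner_shift (a : ℝ) :
    Integrable (fun x : ι → ℝ => ∑ i, θ i * (a * θ i + x i)) (stdGauss ι) :=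
  integrable_finsetSum _ fun i _ => ((memLp_shift θ a i).integrable (by norm_num)).const_mul _

omit h in
lemma hasDerivAt_shiftSq (a : ℝ) (x : ι → ℝ) :
    HasDerivAt (fun a => shiftSq θ a x) (2 * ∑ i, θ i * (a * θ i + x i)) a := by
  unfold shiftSq
  rw [Finset.mul_sum]
  refine HasDerivAt.fun_sum fun i _ => ?_
  have h1 : HasDerivAt (fun a : ℝ => a * θ i + x i) (θ i) a := by
    simpa using ((hasDerivAt_id a).mul_const (θ i)).add_const (x i)
  refine (h1.fun_pow 2).congr_deriv ?_
  simp
  ring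

lemma ShrinkageProfile.hasDerivAt_integral (a : ℝ) :
    HasDerivAt (fun a => ∫ x, f (shiftSq θ a x) ∂(stdGauss ι)) (-meanCorrection κ θ a) a := by
  have key := hasDerivAt_integral_of_dominated_loc_of_deriv_le (μ := stdGauss ι)
    (F := fun a x => f (shiftSq θ a x))
    (F' := fun a x => -(κ (shiftSq θ a x) * ∑ i, θ i * (a * θ i + x i)))
    (x₀ := a) (s := Metric.ball a 1)
    (bound := fun x => ∑ i, |θ i| * ((|a| + 1) * |θ i| + |x i|))
    (Metric.ball_mem_nhds a one_pos)
    (Filter.Eventually.of_forall fun b => (h.integrable_comp_shiftSq θ b).aestronglyMeasurable)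
    (h.integrable_comp_shiftSq θ a)
    (h.integrable_shrink_mul θ a (integrable_inner_shift θ a)).neg.aestronglyMeasurable
    (ae_of_all _ fun x b hb => ?_) ?_ (ae_of_all _ fun x b _ => ?_)
  · have h2 := key.2
    rw [integral_neg] at h2
    exact h2
  · rw [norm_neg, Real.norm_eq_abs, abs_mul, abs_of_nonneg (h.nonneg _)]
    refine (mul_le_of_le_one_left (abs_nonneg _) (h.le_one _)).trans
      ((Finset.abs_sum_le_sum_abs _ _).trans (Finset.sum_le_sum fun i _ => ?_))
    rw [abs_mul]
    refine mul_le_mul_of_nonneg_left ((abs_add_le _ _).trans ?_) (abs_nonneg _)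
    rw [abs_mul]
    have hb' : |b| ≤ |a| + 1 := by
      rw [Metric.mem_ball, Real.dist_eq] at hb
      have := abs_sub_abs_le_abs_sub b a
      linarith
    gcongr
  · refine integrable_finsetSum _ fun i _ => Integrable.const_mul ?_ _
    exact (integrable_const _).add ((memLp_eval_stdGauss i).integrable (by norm_num)).abs
  · refine ((h.hasDerivAt _).comp b (hasDerivAt_shiftSq θ b x)).congr_deriv ?_
    ring

/-- Under the reflection `x ↦ -x` of the noise, larger values of `⟪θ, x⟫` go with larger norms and
hence with smaller shrinkage factors. -/
lemma ShrinkageProfile.meanCorrection_le {a : ℝ} (ha : 0 ≤ a) :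
    meanCorrection κ θ a ≤
      a * (∑ i, θ i ^ 2) * ∫ x, κ (shiftSq θ a x) ∂(stdGauss ι) := by
  have hi1 : Integrable (fun x : ι → ℝ => κ (shiftSq θ a x) * ∑ i, θ i * x i) (stdGauss ι) :=
    h.integrable_shrink_mul θ a (integrable_finsetSum _ fun i _ =>
      ((memLp_eval_stdGauss i).integrable (by norm_num)).const_mul _)
  have hi0 := h.integrable_shrink θ a
  have hneg : MeasurePreserving (fun x : ι → ℝ => -x) (stdGauss ι) (stdGauss ι) :=
    ⟨measurable_neg, stdGauss_map_neg⟩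
  have hi2 : Integrable (fun x : ι → ℝ => κ (shiftSq θ a (-x)) * ∑ i, θ i * (-x) i)
      (stdGauss ι) := hneg.integrable_comp_of_integrable hi1
  have hflip : ∫ x, κ (shiftSq θ a (-x)) * ∑ i, θ i * (-x) i ∂(stdGauss ι) =
      ∫ x, κ (shiftSq θ a x) * ∑ i, θ i * x i ∂(stdGauss ι) :=
    hneg.integral_comp (MeasurableEquiv.neg (ι → ℝ)).measurableEmbedding
      (fun x : ι → ℝ => κ (shiftSq θ a x) * ∑ i, θ i * x i)
  have hnonpos : ∫ x, κ (shiftSq θ a x) * ∑ i, θ i * x i ∂(stdGauss ι) ≤ 0 := by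
    have h2 : ∫ x, (κ (shiftSq θ a x) * ∑ i, θ i * x i +
        κ (shiftSq θ a (-x)) * ∑ i, θ i * (-x) i) ∂(stdGauss ι) ≤ 0 := by
      refine integral_nonpos fun x => ?_
      have h3 : shiftSq θ a x - shiftSq θ a (-x) = 4 * a * ∑ i, θ i * x i := by
        unfold shiftSq
        rw [← Finset.sum_sub_distrib, Finset.mul_sum]
        refine Finset.sum_congr rfl fun i _ => ?_
        simp only [Pi.neg_apply]
        ring
      have h4 : ∑ i, θ i * (-x) i = -∑ i, θ i * x i := by
        rw [← Finset.sum_neg_distrib]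
        exact Finset.sum_congr rfl fun i _ => by simp
      simp only [Pi.zero_apply, h4]
      rcases le_total 0 (∑ i, θ i * x i) with hs | hs
      · have h5 := h.antitone (show shiftSq θ a (-x) ≤ shiftSq θ a x by
          nlinarith [mul_nonneg ha hs])
        nlinarith
      · have h5 := h.antitone (show shiftSq θ a x ≤ shiftSq θ a (-x) by
          nlinarith [mul_nonneg ha (neg_nonneg.2 hs)])
        nlinarith
    rw [integral_add hi1 hi2, hflip] at h2
    linarith
  have hsplit : meanCorrection κ θ a = a * (∑ i, θ i ^ 2) * ∫ x, κ (shiftSq θ a x) ∂(stdGauss ι) +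
      ∫ x, κ (shiftSq θ a x) * ∑ i, θ i * x i ∂(stdGauss ι) := by
    rw [meanCorrection, ← integral_const_mul, ← integral_add (hi0.const_mul _) hi1]
    refine integral_congr_ae (ae_of_all _ fun x => ?_)
    have h6 : ∑ i, θ i * (a * θ i + x i) = a * (∑ i, θ i ^ 2) + ∑ i, θ i * x i := by
      rw [Finset.mul_sum, ← Finset.sum_add_distrib]
      exact Finset.sum_congr rfl fun i _ => by ring
    simp only [h6]
    ring
  linarith

/-- Stein's identity for the shrinkage correction, as for the James–Stein estimator. -/
lemma ShrinkageProfile.mul_meanCorrection_le (hn : n = (Fintype.card ι : ℝ) - 2) (a : ℝ) :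
    a * meanCorrection κ θ a ≤ n * (1 - ∫ x, κ (shiftSq θ a x) ∂(stdGauss ι)) := by
  classical
  have hi0 := h.integrable_shrink θ a
  have hig : ∀ i, Integrable (fun x => κ (shiftSq θ a x) * (a * θ i + x i)) (stdGauss ι) :=
    fun i => h.integrable_shrink_mul θ a ((memLp_shift θ a i).integrable (by norm_num))
  have hixg : ∀ i, Integrable (fun x => x i * (κ (shiftSq θ a x) * (a * θ i + x i)))
      (stdGauss ι) := by
    intro i
    have h1 := h.integrable_shrink_mul θ a
      ((memLp_eval_stdGauss i).integrable_mul (memLp_shift θ a i))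
    refine h1.congr (ae_of_all _ fun x => ?_)
    simp only [Pi.mul_apply]
    ring
  have hig' : ∀ i, Integrable (fun x => κ (shiftSq θ a x) +
      2 * (κ' (shiftSq θ a x) * (a * θ i + x i) ^ 2)) (stdGauss ι) :=
    fun i => hi0.add ((h.integrable_deriv_mul θ a (memLp_shift θ a i).integrable_sq).const_mul 2)
  have hstein : ∀ i, ∫ x, x i * (κ (shiftSq θ a x) * (a * θ i + x i)) ∂(stdGauss ι) =
      ∫ x, (κ (shiftSq θ a x) + 2 * (κ' (shiftSq θ a x) * (a * θ i + x i) ^ 2))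
        ∂(stdGauss ι) := by
    intro i
    refine integral_coord_mul_stdGauss i (hig i) (hixg i) (hig' i) fun x => ?_
    unfold HasLineDerivAt
    have h1 : ∀ j, HasDerivAt
        (fun t : ℝ => a * θ j + (x + t • Pi.single (M := fun _ => ℝ) i 1) j)
        (Pi.single (M := fun _ => ℝ) i 1 j) 0 := by
      intro j
      simpa using (((hasDerivAt_id (0 : ℝ)).mul_const
          (Pi.single (M := fun _ => ℝ) i 1 j)).const_add (x j)).const_add (a * θ j)
    have h2 : HasDerivAt (fun t : ℝ => shiftSq θ a (x + t • Pi.single (M := fun _ => ℝ) i 1))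
        (2 * (a * θ i + x i)) 0 := by
      unfold shiftSq
      have h3 := HasDerivAt.fun_sum (u := Finset.univ) fun j _ => (h1 j).fun_pow 2
      refine h3.congr_deriv ?_
      simp [Pi.single_apply]
    have h0 : x + (0 : ℝ) • Pi.single (M := fun _ => ℝ) i 1 = x := by simp
    have h4 : HasDerivAt
        (fun t : ℝ => κ (shiftSq θ a (x + t • Pi.single (M := fun _ => ℝ) i 1)))
        (κ' (shiftSq θ a x) * (2 * (a * θ i + x i))) 0 :=
      HasDerivAt.comp (0 : ℝ) (by rw [h0]; exact h.hasDerivAt_shrink _) h2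
    refine (h4.fun_mul (h1 i)).congr_deriv ?_
    rw [h0]
    simp
    ring
  -- `⟪Z, κ Z⟫ = ⟪a • θ, κ Z⟫ + ⟪x, κ Z⟫` for `Z = a • θ + x`; the last term is integrated by parts.
  have hsum : a * meanCorrection κ θ a = ∫ x, (κ (shiftSq θ a x) * shiftSq θ a x -
      ∑ i, x i * (κ (shiftSq θ a x) * (a * θ i + x i))) ∂(stdGauss ι) := by
    rw [meanCorrection, ← integral_const_mul]
    refine integral_congr_ae (ae_of_all _ fun x => ?_)
    simp only
    nth_rw 3 [shiftSq]
    rw [Finset.mul_sum, Finset.mul_sum, Finset.mul_sum, ← Finset.sum_sub_distrib]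
    exact Finset.sum_congr rfl fun i _ => by ring
  have hiS := h.integrable_shrink_mul θ a (integrable_shiftSq θ a)
  have hsum' : a * meanCorrection κ θ a = ∫ x, (κ (shiftSq θ a x) * shiftSq θ a x -
      ∑ i, (κ (shiftSq θ a x) + 2 * (κ' (shiftSq θ a x) * (a * θ i + x i) ^ 2)))
        ∂(stdGauss ι) := by
    rw [hsum, integral_sub hiS (integrable_finsetSum _ fun i _ => hixg i),
      integral_sub hiS (integrable_finsetSum _ fun i _ => hig' i),
      integral_finsetSum _ fun i _ => hixg i, integral_finsetSum _ fun i _ => hig' i]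
    simp_rw [hstein]
  have hfin : n * (1 - ∫ x, κ (shiftSq θ a x) ∂(stdGauss ι)) =
      ∫ x, (n - n * κ (shiftSq θ a x)) ∂(stdGauss ι) := by
    rw [integral_sub (integrable_const _) (hi0.const_mul _), integral_const_mul]
    simp
    ring
  rw [hsum', hfin]
  refine integral_mono (hiS.sub (integrable_finsetSum _ fun i _ => hig' i))
    ((integrable_const _).sub (hi0.const_mul _)) fun x => ?_
  have hq := shiftSq_nonneg θ a x
  have h1 := h.mul_le _ hq
  have h2 := h.deriv_mul_nonneg _ hq
  have h3 : ∑ i, (κ (shiftSq θ a x) + 2 * (κ' (shiftSq θ a x) * (a * θ i + x i) ^ 2)) =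
      Fintype.card ι * κ (shiftSq θ a x) + 2 * (κ' (shiftSq θ a x) * shiftSq θ a x) := by
    rw [Finset.sum_add_distrib, ← Finset.mul_sum, ← Finset.mul_sum]
    simp [shiftSq]
  simp only [h3]
  rw [hn] at h1 ⊢
  linarith

/-- The expected logarithm of the marginal density decreases no faster in the signal than the
logarithm for the best linear estimator. -/
lemma ShrinkageProfile.integral_sub_le (hn : n = (Fintype.card ι : ℝ) - 2) (hn0 : 0 < n)
    {a b : ℝ} (ha : 0 ≤ a) (hab : a ≤ b) :
    ∫ x, f (shiftSq θ a x) ∂(stdGauss ι) - ∫ x, f (shiftSq θ b x) ∂(stdGauss ι) ≤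
      n / 2 * (Real.log (n + b ^ 2 * ∑ i, θ i ^ 2) - Real.log (n + a ^ 2 * ∑ i, θ i ^ 2)) := by
  set T := ∑ i, θ i ^ 2 with hT
  have hT0 : 0 ≤ T := Finset.sum_nonneg fun _ _ => sq_nonneg _
  have hpos : ∀ c : ℝ, 0 < n + c ^ 2 * T := fun c => by positivity
  have hd : ∀ c, HasDerivAt (fun c => ∫ x, f (shiftSq θ c x) ∂(stdGauss ι) +
      n / 2 * Real.log (n + c ^ 2 * T))
      (-meanCorrection κ θ c + n / 2 * (2 * c * T / (n + c ^ 2 * T))) c := by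
    intro c
    have h1 : HasDerivAt (fun c : ℝ => n + c ^ 2 * T) (2 * c * T) c := by
      simpa using ((hasDerivAt_pow 2 c).mul_const T).const_add n
    exact (h.hasDerivAt_integral θ c).add ((h1.log (hpos c).ne').const_mul _)
  have hmono : MonotoneOn (fun c => ∫ x, f (shiftSq θ c x) ∂(stdGauss ι) +
      n / 2 * Real.log (n + c ^ 2 * T)) (Set.Ici 0) := by
    refine monotoneOn_of_hasDerivWithinAt_nonneg (convex_Ici 0)
      (fun c _ => (hd c).continuousAt.continuousWithinAt)
      (fun c _ => (hd c).hasDerivWithinAt) fun c hc => ?_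
    rw [interior_Ici, Set.mem_Ioi] at hc
    have h1 := h.meanCorrection_le θ hc.le
    have h2 := h.mul_meanCorrection_le θ hn c
    rw [← hT] at h1
    set k := ∫ x, κ (shiftSq θ c x) ∂(stdGauss ι)
    -- Weighting the two bounds eliminates the mean shrinkage factor `k`.
    have h3 : (n + c ^ 2 * T) * meanCorrection κ θ c ≤ n * (c * T) := by
      nlinarith [mul_le_mul_of_nonneg_left h1 hn0.le,
        mul_le_mul_of_nonneg_left h2 (mul_nonneg hc.le hT0)]
    have h4 : meanCorrection κ θ c ≤ n * (c * T) / (n + c ^ 2 * T) := by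
      rw [le_div_iff₀ (hpos c)]
      linarith
    have h5 : n / 2 * (2 * c * T / (n + c ^ 2 * T)) = n * (c * T) / (n + c ^ 2 * T) := by ring
    linarith
  have := hmono (Set.mem_Ici.2 ha) (Set.mem_Ici.2 (ha.trans hab)) hab
  simp only at this
  linarith

end Radial

/-! ### The marginal density of the Stein prior as a function of the squared norm -/

/-- The measure `y ^ (b / 2 - 2) dy` on `(0, 1)`. The marginal density of an observation in
dimension `b` for the prior density `‖θ‖ ^ (2 - b)` is a multiple of its Laplace transform. -/
def radialMeasure (b : ℕ) : Measure ℝ :=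
  (volume.restrict (Set.Ioo 0 1)).withDensity fun y => ENNReal.ofReal (y ^ ((b : ℝ) / 2 - 2))

/-- The logarithm of the Laplace transform of `radialMeasure b`. -/
def steinLog (b : ℕ) (r : ℝ) : ℝ := cgf id (radialMeasure b) (-r / 2)

section RadialMeasure
variable {b : ℕ}

lemma measurable_rpow_ofReal (p : ℝ) : Measurable fun y : ℝ => ENNReal.ofReal (y ^ p) := by
  fun_prop

lemma ae_radialMeasure (b : ℕ) : ∀ᵐ y ∂(radialMeasure b), y ∈ Set.Ioo (0 : ℝ) 1 :=
  (withDensity_absolutelyContinuous _ _).ae_le (ae_restrict_mem measurableSet_Ioo)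

lemma integrableOn_rpow {b : ℕ} (hb : 2 < b) :
    IntegrableOn (fun y : ℝ => y ^ ((b : ℝ) / 2 - 2)) (Set.Ioo 0 1) := by
  have hb' : (2 : ℝ) < b := by exact_mod_cast hb
  have h := intervalIntegral.intervalIntegrable_rpow' (a := 0) (b := 1)
    (r := (b : ℝ) / 2 - 2) (by linarith)
  rw [intervalIntegrable_iff_integrableOn_Ioc_of_le zero_le_one] at h
  exact h.mono_set Set.Ioo_subset_Ioc_self

lemma isFiniteMeasure_radialMeasure (hb : 2 < b) : IsFiniteMeasure (radialMeasure b) :=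
  isFiniteMeasure_withDensity_ofReal (integrableOn_rpow hb).2

lemma radialMeasure_ne_zero (b : ℕ) : radialMeasure b ≠ 0 := by
  intro h
  have h1 : (volume.restrict (Set.Ioo (0 : ℝ) 1)).withDensity
      (fun y => ENNReal.ofReal (y ^ ((b : ℝ) / 2 - 2))) = 0 := h
  rw [withDensity_eq_zero_iff (measurable_rpow_ofReal _).aemeasurable] at h1
  have h2 : ∀ᵐ y ∂(volume.restrict (Set.Ioo (0 : ℝ) 1)), False := by
    filter_upwards [h1, ae_restrict_mem measurableSet_Ioo] with y hy hy'
    simp only [Pi.zero_apply, ENNReal.ofReal_eq_zero] at hy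
    exact absurd (Real.rpow_pos_of_pos hy'.1 _) (not_lt.2 hy)
  rw [Filter.eventually_false_iff_eq_bot, ae_eq_bot, Measure.restrict_eq_zero] at h2
  simp at h2

lemma integral_radialMeasure (b : ℕ) (g : ℝ → ℝ) :
    ∫ y, g y ∂(radialMeasure b) = ∫ y in Set.Ioo 0 1, y ^ ((b : ℝ) / 2 - 2) * g y := by
  rw [radialMeasure, integral_withDensity_eq_integral_toReal_smul (measurable_rpow_ofReal _)
    (ae_of_all _ fun _ => ENNReal.ofReal_lt_top)]
  refine setIntegral_congr_fun measurableSet_Ioo fun y hy => ?_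
  simp only [smul_eq_mul]
  rw [ENNReal.toReal_ofReal (Real.rpow_nonneg hy.1.le _)]

lemma integrable_radialMeasure_of_bounded (hb : 2 < b) {g : ℝ → ℝ} (hg : Measurable g) {C : ℝ}
    (h : ∀ y ∈ Set.Ioo (0 : ℝ) 1, |g y| ≤ C) : Integrable g (radialMeasure b) := by
  have := isFiniteMeasure_radialMeasure hb
  exact Integrable.of_bound hg.aestronglyMeasurable C ((ae_radialMeasure b).mono h)

lemma abs_mul_exp_le (t : ℝ) (y : ℝ) (hy : y ∈ Set.Ioo (0 : ℝ) 1) (k : ℕ) :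
    |y ^ k * Real.exp (t * y)| ≤ Real.exp |t| := by
  rw [abs_mul, Real.abs_exp, abs_of_nonneg (pow_nonneg hy.1.le k)]
  have h1 : y ^ k ≤ 1 := pow_le_one₀ hy.1.le hy.2.le
  have h2 : t * y ≤ |t| := by
    calc t * y ≤ |t| * y := mul_le_mul_of_nonneg_right (le_abs_self t) hy.1.le
      _ ≤ |t| := mul_le_of_le_one_right (abs_nonneg t) hy.2.le
  calc y ^ k * Real.exp (t * y) ≤ 1 * Real.exp (t * y) :=
        mul_le_mul_of_nonneg_right h1 (Real.exp_pos _).le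
    _ ≤ Real.exp |t| := by rw [one_mul]; exact Real.exp_le_exp.2 h2

lemma integrable_pow_mul_exp (hb : 2 < b) (t : ℝ) (k : ℕ) :
    Integrable (fun y => y ^ k * Real.exp (t * y)) (radialMeasure b) :=
  integrable_radialMeasure_of_bounded hb (by fun_prop) fun y hy => abs_mul_exp_le t y hy k

lemma integrable_exp_radialMeasure (hb : 2 < b) (t : ℝ) :
    Integrable (fun y => Real.exp (t * id y)) (radialMeasure b) := by
  simpa using integrable_pow_mul_exp hb t 0

lemma mem_interior_integrableExpSet (hb : 2 < b) (t : ℝ) :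
    t ∈ interior (integrableExpSet id (radialMeasure b)) := by
  rw [show integrableExpSet id (radialMeasure b) = Set.univ from
    Set.eq_univ_of_forall fun t => integrable_exp_radialMeasure hb t, interior_univ]
  trivial

lemma mgf_radialMeasure_pos (hb : 2 < b) (t : ℝ) : 0 < mgf id (radialMeasure b) t :=
  mgf_pos' (radialMeasure_ne_zero b) (integrable_exp_radialMeasure hb t)

lemma integral_pow_mul_exp_le (hb : 2 < b) (t : ℝ) (k : ℕ) :
    (∫ y, y ^ k * Real.exp (t * y) ∂(radialMeasure b)) / mgf id (radialMeasure b) t ≤ 1 := by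
  rw [div_le_one (mgf_radialMeasure_pos hb t)]
  refine integral_mono_ae (integrable_pow_mul_exp hb t k) (integrable_exp_radialMeasure hb t) ?_
  filter_upwards [ae_radialMeasure b] with y hy
  exact mul_le_of_le_one_left (Real.exp_pos _).le (pow_le_one₀ hy.1.le hy.2.le)

/-- Integration by parts for the Laplace transform of `radialMeasure b`. -/
lemma mul_integral_mul_exp (hb : 2 < b) (t : ℝ) :
    ((b : ℝ) / 2 - 1) * mgf id (radialMeasure b) t +
      t * ∫ y, y * Real.exp (t * y) ∂(radialMeasure b) = Real.exp t := by
  have hb' : (2 : ℝ) < b := by exact_mod_cast hb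
  set p := (b : ℝ) / 2 - 2 with hp
  have hi0 : Integrable (fun y => Real.exp (t * y)) (radialMeasure b) :=
    integrable_exp_radialMeasure hb t
  have hi1 : Integrable (fun y => y * Real.exp (t * y)) (radialMeasure b) := by
    simpa using integrable_pow_mul_exp hb t 1
  have hi : Integrable (fun y => (p + 1) * Real.exp (t * y) + t * (y * Real.exp (t * y)))
      (radialMeasure b) := (hi0.const_mul _).add (hi1.const_mul _)
  have hderiv : ∀ y ∈ Set.Ioo (0 : ℝ) 1, HasDerivAt (fun y => y ^ (p + 1) * Real.exp (t * y))
      (y ^ p * ((p + 1) * Real.exp (t * y) + t * (y * Real.exp (t * y)))) y := by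
    intro y hy
    have h1 := Real.hasDerivAt_rpow_const (x := y) (p := p + 1) (Or.inl hy.1.ne')
    have h2 : HasDerivAt (fun y => Real.exp (t * y)) (Real.exp (t * y) * t) y := by
      simpa using ((hasDerivAt_id y).const_mul t).exp
    refine (h1.fun_mul h2).congr_deriv ?_
    rw [add_sub_cancel_right, Real.rpow_add_one hy.1.ne']
    ring
  have hint : IntervalIntegrable
      (fun y => y ^ p * ((p + 1) * Real.exp (t * y) + t * (y * Real.exp (t * y)))) volume 0 1 := by
    rw [intervalIntegrable_iff_integrableOn_Ioc_of_le zero_le_one, integrableOn_Ioc_iff_integrableOn_Ioo]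
    rw [radialMeasure, integrable_withDensity_iff_integrable_smul₀'
      (measurable_rpow_ofReal _).aemeasurable (ae_of_all _ fun _ => ENNReal.ofReal_lt_top)] at hi
    refine hi.congr ?_
    filter_upwards [ae_restrict_mem measurableSet_Ioo] with y hy
    rw [ENNReal.toReal_ofReal (Real.rpow_nonneg hy.1.le _), smul_eq_mul]
  have hftc := intervalIntegral.integral_eq_sub_of_hasDerivAt_of_le zero_le_one
    (f := fun y => y ^ (p + 1) * Real.exp (t * y)) (by
      refine ContinuousOn.mul ?_ (by fun_prop)
      exact (Real.continuous_rpow_const (by rw [hp]; linarith)).continuousOn) hderiv hint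
  rw [intervalIntegral.integral_of_le zero_le_one, integral_Ioc_eq_integral_Ioo,
    ← integral_radialMeasure, integral_add (hi0.const_mul _) (hi1.const_mul _),
    integral_const_mul, integral_const_mul, Real.zero_rpow (by rw [hp]; linarith)] at hftc
  simp only [Real.one_rpow, one_mul, mul_one, zero_mul, sub_zero] at hftc
  rw [← hftc, hp]
  simp only [mgf, id]
  ring

lemma deriv_cgf_radialMeasure (hb : 2 < b) (t : ℝ) :
    deriv (cgf id (radialMeasure b)) t =
      (∫ y, y * Real.exp (t * y) ∂(radialMeasure b)) / mgf id (radialMeasure b) t := by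
  rw [deriv_cgf (mem_interior_integrableExpSet hb t)]
  rfl

/-- The logarithmic Laplace transform of `radialMeasure b` is a shrinkage profile: its first two
derivatives are the mean and the variance of a tilted law on `(0, 1)`, and integration by parts
gives the bounds on `r * κ r`. -/
lemma shrinkageProfile_steinLog (hb : 2 < b) :
    ShrinkageProfile ((b : ℝ) - 2) (steinLog b)
      (fun r => deriv (cgf id (radialMeasure b)) (-r / 2))
      (fun r => -(iteratedDeriv 2 (cgf id (radialMeasure b)) (-r / 2)) / 2) := by
  have hlin : ∀ r : ℝ, HasDerivAt (fun r : ℝ => -r / 2) (-1 / 2) r := fun r =>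
    (hasDerivAt_id r).fun_neg.div_const 2
  have hf : ∀ r, HasDerivAt (steinLog b) (-deriv (cgf id (radialMeasure b)) (-r / 2) / 2) r := by
    intro r
    have h1 := (analyticAt_cgf
      (mem_interior_integrableExpSet hb (-r / 2))).differentiableAt.hasDerivAt
    refine (h1.comp r (hlin r)).congr_deriv ?_
    ring
  have hκ : ∀ r, HasDerivAt (fun r => deriv (cgf id (radialMeasure b)) (-r / 2))
      (-(iteratedDeriv 2 (cgf id (radialMeasure b)) (-r / 2)) / 2) r := by
    intro r
    have h1 := (analyticAt_cgf
      (mem_interior_integrableExpSet hb (-r / 2))).deriv.differentiableAt.hasDerivAt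
    refine (h1.comp r (hlin r)).congr_deriv ?_
    rw [iteratedDeriv_succ, iteratedDeriv_one]
    ring
  have hle : ∀ r, deriv (cgf id (radialMeasure b)) (-r / 2) ≤ 1 := by
    intro r
    rw [deriv_cgf_radialMeasure hb]
    simpa using integral_pow_mul_exp_le hb (-r / 2) 1
  have hq : ∀ r, r * deriv (cgf id (radialMeasure b)) (-r / 2) =
      (b : ℝ) - 2 - 2 * Real.exp (-r / 2 - steinLog b r) := by
    intro r
    have hM := mgf_radialMeasure_pos hb (-r / 2)
    have h1 := mul_integral_mul_exp hb (-r / 2)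
    rw [Real.exp_sub, steinLog, cgf, Real.exp_log hM, deriv_cgf_radialMeasure hb, ← h1]
    generalize mgf id (radialMeasure b) (-r / 2) = M at hM ⊢
    generalize ∫ y, y * Real.exp (-r / 2 * y) ∂(radialMeasure b) = I
    field_simp
    ring
  refine ⟨hf, hκ, fun r => ?_, hle, fun r => ?_, fun r => ?_, fun r _ => ?_, fun r _ => ?_⟩
  · rw [deriv_cgf_radialMeasure hb]
    refine div_nonneg (integral_nonneg_of_ae ?_) (mgf_radialMeasure_pos hb _).le
    filter_upwards [ae_radialMeasure b] with y hy
    exact mul_nonneg hy.1.le (Real.exp_pos _).le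
  · have h1 : 0 ≤ iteratedDeriv 2 (cgf id (radialMeasure b)) (-r / 2) := by
      rw [iteratedDeriv_two_cgf_eq_integral (mem_interior_integrableExpSet hb _)]
      exact div_nonneg (integral_nonneg fun y => by positivity) (mgf_radialMeasure_pos hb _).le
    linarith
  · have h1 : iteratedDeriv 2 (cgf id (radialMeasure b)) (-r / 2) ≤ 1 := by
      rw [iteratedDeriv_two_cgf (mem_interior_integrableExpSet hb _)]
      have h2 := integral_pow_mul_exp_le hb (-r / 2) 2
      simp only [id] at h2 ⊢
      nlinarith [sq_nonneg (deriv (cgf (fun y => y) (radialMeasure b)) (-r / 2))]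
    linarith
  · rw [hq]
    linarith [Real.exp_pos (-r / 2 - steinLog b r)]
  · have h1 : HasDerivAt (fun r => r * deriv (cgf id (radialMeasure b)) (-r / 2))
        (1 * deriv (cgf id (radialMeasure b)) (-r / 2) +
          r * (-(iteratedDeriv 2 (cgf id (radialMeasure b)) (-r / 2)) / 2)) r :=
      (hasDerivAt_id r).fun_mul (hκ r)
    have h2 := ((((hlin r).fun_sub (hf r)).exp).const_mul 2).const_sub ((b : ℝ) - 2)
    rw [← funext hq] at h2
    have h3 := h1.unique h2
    rw [one_mul] at h3
    rw [h3]
    have h4 := hle r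
    have h5 := Real.exp_pos (-r / 2 - steinLog b r)
    nlinarith

end RadialMeasure

/-! ### The marginal density of the Stein prior on one block -/

lemma lintegral_exp_neg_sq_gaussianReal {s : ℝ≥0} {w : ℝ} (hw : 0 < w) (z : ℝ) :
    ∫⁻ x, ENNReal.ofReal (Real.exp (-(w * x ^ 2 / 2))) ∂(gaussianReal z s) =
      ENNReal.ofReal ((1 + s * w) ^ (-(1 / 2) : ℝ) *
        Real.exp (-(w * z ^ 2 / (2 * (1 + s * w))))) := by
  set u : ℝ≥0 := ⟨w⁻¹, by positivity⟩ with hu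
  have hu0 : u ≠ 0 := by
    rw [← NNReal.coe_ne_zero]
    exact (inv_pos.2 hw).ne'
  have huw : (u : ℝ) = w⁻¹ := rfl
  have hs0 : (0 : ℝ) ≤ s := s.2
  have h1 : ∀ x, ENNReal.ofReal (Real.exp (-(w * x ^ 2 / 2))) =
      ENNReal.ofReal (√(2 * Real.pi * w⁻¹)) * gaussianPDF x u 0 := by
    intro x
    rw [gaussianPDF, ← ENNReal.ofReal_mul (Real.sqrt_nonneg _), gaussianPDFReal, huw, ← mul_assoc,
      mul_inv_cancel₀ (by positivity), one_mul]
    congr 2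
    field_simp
    ring
  simp_rw [h1]
  rw [lintegral_const_mul _ (by fun_prop), lintegral_gaussianPDF_gaussianReal hu0, gaussianPDF,
    ← ENNReal.ofReal_mul (Real.sqrt_nonneg _), gaussianPDFReal, NNReal.coe_add, huw, ← mul_assoc]
  congr 2
  · rw [Real.rpow_neg (by positivity), ← Real.sqrt_eq_rpow, ← Real.sqrt_inv, ← Real.sqrt_inv,
      ← Real.sqrt_mul (by positivity)]
    congr 1
    field_simp
  · congr 1
    field_simp
    ring

/-- Stein's prior density as a scale mixture of Gaussian densities. -/
lemma ofReal_zpow_norm_eq_lintegral {b : ℕ} (hb : 2 < b) {T : ℝ} (hT : 0 < T) :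
    ENNReal.ofReal (√T ^ (2 - (b : ℤ))) =
      ENNReal.ofReal ((2 ^ ((b : ℝ) / 2 - 1) * Real.Gamma ((b : ℝ) / 2 - 1))⁻¹) *
        ∫⁻ w in Set.Ioi (0 : ℝ), ENNReal.ofReal (w ^ ((b : ℝ) / 2 - 2)) *
          ENNReal.ofReal (Real.exp (-(w * T / 2))) := by
  have hb' : (2 : ℝ) < b := by exact_mod_cast hb
  have ha : 0 < (b : ℝ) / 2 - 1 := by linarith
  have hΓ := Real.Gamma_pos_of_pos ha
  have h1 := Real.integral_rpow_mul_exp_neg_mul_Ioi ha (half_pos hT)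
  rw [show (b : ℝ) / 2 - 1 - 1 = (b : ℝ) / 2 - 2 by ring] at h1
  have hpos : 0 < (1 / (T / 2)) ^ ((b : ℝ) / 2 - 1) * Real.Gamma ((b : ℝ) / 2 - 1) := by positivity
  have hint : IntegrableOn (fun w : ℝ => w ^ ((b : ℝ) / 2 - 2) * Real.exp (-(T / 2 * w)))
      (Set.Ioi 0) := by
    apply Integrable.of_integral_ne_zero
    rw [h1]
    exact hpos.ne'
  have h2 : ∫⁻ w in Set.Ioi (0 : ℝ), ENNReal.ofReal (w ^ ((b : ℝ) / 2 - 2)) *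
          ENNReal.ofReal (Real.exp (-(w * T / 2))) =
      ENNReal.ofReal ((1 / (T / 2)) ^ ((b : ℝ) / 2 - 1) * Real.Gamma ((b : ℝ) / 2 - 1)) := by
    rw [← h1, ofReal_integral_eq_lintegral_ofReal hint]
    · refine setLIntegral_congr_fun measurableSet_Ioi fun w hw => ?_
      rw [← ENNReal.ofReal_mul (Real.rpow_nonneg (le_of_lt hw) _)]
      congr 3
      ring
    · filter_upwards [ae_restrict_mem measurableSet_Ioi] with w hw
      exact mul_nonneg (Real.rpow_nonneg (le_of_lt hw) _) (Real.exp_pos _).le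
  rw [h2, ← ENNReal.ofReal_mul (by positivity)]
  congr 1
  have h3 : √T ^ (2 - (b : ℤ)) = (T ^ ((b : ℝ) / 2 - 1))⁻¹ := by
    rw [← Real.rpow_intCast, Real.sqrt_eq_rpow, ← Real.rpow_mul hT.le, ← Real.rpow_neg hT.le]
    congr 1
    push_cast
    ring
  rw [h3, one_div_div, Real.div_rpow (by norm_num) hT.le]
  generalize Real.Gamma ((b : ℝ) / 2 - 1) = Γ at hΓ ⊢
  field_simp

/-- The substitution `y = s w / (1 + s w)` turns the mixture over precisions `w` into the Laplace
transform of `radialMeasure b`. -/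
lemma lintegral_precision {b : ℕ} (hb : 2 < b) {s : ℝ} (hs : 0 < s) (Z : ℝ) :
    ∫⁻ w in Set.Ioi (0 : ℝ), ENNReal.ofReal (w ^ ((b : ℝ) / 2 - 2)) *
        ENNReal.ofReal ((1 + s * w) ^ (-((b : ℝ) / 2)) *
          Real.exp (-(w * Z / (2 * (1 + s * w))))) =
      ENNReal.ofReal (Real.exp ((1 - (b : ℝ) / 2) * Real.log s + steinLog b (Z / s))) := by
  have hM := mgf_radialMeasure_pos hb (-(Z / s) / 2)
  have himg : (fun w : ℝ => s * w / (1 + s * w)) '' Set.Ioi 0 = Set.Ioo 0 1 := by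
    ext y
    simp only [Set.mem_image, Set.mem_Ioi, Set.mem_Ioo]
    constructor
    · rintro ⟨w, hw, rfl⟩
      have : 0 < s * w := mul_pos hs hw
      exact ⟨by positivity, by rw [div_lt_one (by positivity)]; linarith⟩
    · rintro ⟨h0, h1⟩
      have h2 : 0 < 1 - y := by linarith
      refine ⟨y / (s * (1 - y)), by positivity, ?_⟩
      field_simp
      ring
  have hder : ∀ w ∈ Set.Ioi (0 : ℝ), HasDerivWithinAt (fun w : ℝ => s * w / (1 + s * w))
      (s / (1 + s * w) ^ 2) (Set.Ioi 0) w := by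
    intro w hw
    have hw' : 0 < 1 + s * w := by
      have := mul_pos hs (Set.mem_Ioi.1 hw)
      linarith
    have h1 : HasDerivAt (fun w : ℝ => s * w) s w := by
      simpa using (hasDerivAt_id w).const_mul s
    refine ((h1.fun_div (h1.const_add 1) hw'.ne').congr_deriv ?_).hasDerivWithinAt
    field_simp
    ring
  have hinj : Set.InjOn (fun w : ℝ => s * w / (1 + s * w)) (Set.Ioi 0) := by
    intro w hw w' hw' h
    have h1 : 0 < 1 + s * w := by
      have := mul_pos hs (Set.mem_Ioi.1 hw)
      linarith
    have h2 : 0 < 1 + s * w' := by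
      have := mul_pos hs (Set.mem_Ioi.1 hw')
      linarith
    simp only at h
    rw [div_eq_div_iff h1.ne' h2.ne'] at h
    have h3 : s * w = s * w' := by linarith
    exact mul_left_cancel₀ hs.ne' h3
  have hcov := lintegral_image_eq_lintegral_abs_deriv_mul measurableSet_Ioi hder hinj
    fun y => ENNReal.ofReal (s ^ (1 - (b : ℝ) / 2) *
      (y ^ ((b : ℝ) / 2 - 2) * Real.exp (-(Z / s) / 2 * y)))
  rw [himg] at hcov
  have hlhs : ∫⁻ w in Set.Ioi (0 : ℝ), ENNReal.ofReal (w ^ ((b : ℝ) / 2 - 2)) *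
        ENNReal.ofReal ((1 + s * w) ^ (-((b : ℝ) / 2)) *
          Real.exp (-(w * Z / (2 * (1 + s * w))))) =
      ∫⁻ y in Set.Ioo (0 : ℝ) 1, ENNReal.ofReal (s ^ (1 - (b : ℝ) / 2) *
        (y ^ ((b : ℝ) / 2 - 2) * Real.exp (-(Z / s) / 2 * y))) := by
    rw [hcov]
    refine setLIntegral_congr_fun measurableSet_Ioi fun w hw => ?_
    have hw0 : (0 : ℝ) < w := hw
    have hw' : 0 < 1 + s * w := by positivity
    rw [← ENNReal.ofReal_mul (by positivity), ← ENNReal.ofReal_mul (by positivity)]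
    congr 1
    have he : -(Z / s) / 2 * (s * w / (1 + s * w)) = -(w * Z / (2 * (1 + s * w))) := by
      field_simp
    rw [he, abs_of_pos (by positivity), Real.div_rpow (by positivity) hw'.le,
      Real.mul_rpow hs.le hw0.le, ← mul_assoc, ← mul_assoc, ← mul_assoc]
    congr 1
    have e1 : s ^ (1 - (b : ℝ) / 2) = s ^ (-1 : ℝ) * (s ^ ((b : ℝ) / 2 - 2))⁻¹ := by
      rw [← Real.rpow_neg hs.le, ← Real.rpow_add hs]
      congr 1
      ring
    have e2 : (1 + s * w) ^ (-((b : ℝ) / 2)) =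
        ((1 + s * w) ^ ((b : ℝ) / 2 - 2))⁻¹ * ((1 + s * w) ^ (2 : ℕ))⁻¹ := by
      rw [← Real.rpow_neg hw'.le, ← Real.rpow_natCast, ← Real.rpow_neg hw'.le,
        ← Real.rpow_add hw']
      congr 1
      push_cast
      ring
    have h3 : 0 < s ^ ((b : ℝ) / 2 - 2) := Real.rpow_pos_of_pos hs _
    have h4 : 0 < (1 + s * w) ^ ((b : ℝ) / 2 - 2) := Real.rpow_pos_of_pos hw' _
    rw [e1, e2, Real.rpow_neg_one]
    generalize s ^ ((b : ℝ) / 2 - 2) = A at h3 ⊢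
    generalize (1 + s * w) ^ ((b : ℝ) / 2 - 2) = B at h4 ⊢
    field_simp
  have hint : Integrable (fun y => Real.exp (-(Z / s) / 2 * id y)) (radialMeasure b) :=
    integrable_exp_radialMeasure hb _
  rw [hlhs, Real.exp_add, mul_comm (1 - (b : ℝ) / 2), Real.exp_mul, Real.exp_log hs, steinLog, cgf,
    Real.exp_log hM]
  have hpos : 0 < s ^ (1 - (b : ℝ) / 2) := Real.rpow_pos_of_pos hs _
  simp_rw [ENNReal.ofReal_mul hpos.le]
  rw [lintegral_const_mul' _ _ ENNReal.ofReal_ne_top]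
  congr 1
  rw [mgf, ofReal_integral_eq_lintegral_ofReal hint (ae_of_all _ fun _ => (Real.exp_pos _).le),
    radialMeasure, lintegral_withDensity_eq_lintegral_mul _ (measurable_rpow_ofReal _)
      (by fun_prop)]
  refine setLIntegral_congr_fun measurableSet_Ioo fun y hy => ?_
  simp only [Pi.mul_apply, id]
  rw [ENNReal.ofReal_mul (Real.rpow_nonneg hy.1.le _)]

/-- The logarithm of the marginal density at `z` of an observation with noise variance `s`, for the
prior density `‖θ‖ ^ (2 - b)` in dimension `b`. -/
def blockLog (b : ℕ) (s : ℝ) (z : Fin b → ℝ) : ℝ :=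
  Real.log (2 ^ ((b : ℝ) / 2 - 1) * Real.Gamma ((b : ℝ) / 2 - 1))⁻¹ +
    ((1 - (b : ℝ) / 2) * Real.log s + steinLog b ((∑ k, z k ^ 2) / s))

/-- By the symmetry of the Gaussian density in its mean and its argument, the left-hand side is the
marginal density at `z` under the prior density `‖θ‖ ^ (2 - b)`. -/
lemma lintegral_zpow_norm_gaussian {b : ℕ} (hb : 2 < b) {s : ℝ≥0} (hs : s ≠ 0) (z : Fin b → ℝ) :
    ∫⁻ θ, ENNReal.ofReal (√(∑ k, θ k ^ 2) ^ (2 - (b : ℤ)))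
      ∂(Measure.pi fun k => gaussianReal (z k) s) =
      ENNReal.ofReal (Real.exp (blockLog b s z)) := by
  have hb' : (2 : ℝ) < b := by exact_mod_cast hb
  have hs' : (0 : ℝ) < s := by positivity
  have hΓ := Real.Gamma_pos_of_pos (show 0 < (b : ℝ) / 2 - 1 by linarith)
  have hne : ∀ᵐ θ : Fin b → ℝ ∂(Measure.pi fun k => gaussianReal (z k) s),
      0 < ∑ k, θ k ^ 2 := by
    let k0 : Fin b := ⟨0, by omega⟩
    have h1 : ∀ᵐ θ : Fin b → ℝ ∂(Measure.pi fun k => gaussianReal (z k) s), θ k0 ≠ 0 := by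
      have := nullSingletonClass_gaussianReal (μ := z k0) hs
      have h2 : ∀ᵐ y ∂(gaussianReal (z k0) s), y ≠ 0 := by
        rw [ae_iff]
        simp
      exact (measurePreserving_eval (fun k => gaussianReal (z k) s) k0).quasiMeasurePreserving.ae h2
    filter_upwards [h1] with θ hθ
    exact Finset.sum_pos' (fun _ _ => sq_nonneg _) ⟨k0, Finset.mem_univ _, by positivity⟩
  rw [lintegral_congr_ae (hne.mono fun θ hθ => ofReal_zpow_norm_eq_lintegral hb hθ),
    lintegral_const_mul' _ _ ENNReal.ofReal_ne_top,
    lintegral_lintegral_swap (by fun_prop)]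
  have hw : ∀ w ∈ Set.Ioi (0 : ℝ), ∫⁻ θ : Fin b → ℝ, ENNReal.ofReal (w ^ ((b : ℝ) / 2 - 2)) *
      ENNReal.ofReal (Real.exp (-(w * (∑ k, θ k ^ 2) / 2)))
        ∂(Measure.pi fun k => gaussianReal (z k) s) =
      ENNReal.ofReal (w ^ ((b : ℝ) / 2 - 2)) *
        ENNReal.ofReal ((1 + s * w) ^ (-((b : ℝ) / 2)) *
          Real.exp (-(w * (∑ k, z k ^ 2) / (2 * (1 + s * w))))) := by
    intro w hw
    have hw0 : (0 : ℝ) < w := hw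
    have hw' : 0 < 1 + (s : ℝ) * w := by positivity
    rw [lintegral_const_mul' _ _ ENNReal.ofReal_ne_top]
    congr 1
    have h1 : ∀ θ : Fin b → ℝ, ENNReal.ofReal (Real.exp (-(w * (∑ k, θ k ^ 2) / 2))) =
        ∏ k, ENNReal.ofReal (Real.exp (-(w * θ k ^ 2 / 2))) := by
      intro θ
      rw [← ENNReal.ofReal_prod_of_nonneg fun _ _ => (Real.exp_pos _).le, ← Real.exp_sum]
      congr 2
      rw [Finset.sum_neg_distrib, Finset.mul_sum, Finset.sum_div]
    simp_rw [h1]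
    rw [lintegral_prod_pi _ (f := fun _ x => ENNReal.ofReal (Real.exp (-(w * x ^ 2 / 2))))
      (fun _ => by fun_prop)]
    simp_rw [lintegral_exp_neg_sq_gaussianReal hw0]
    rw [← ENNReal.ofReal_prod_of_nonneg fun _ _ => by positivity, Finset.prod_mul_distrib,
      ← Real.exp_sum, Finset.prod_const, Finset.card_univ, Fintype.card_fin,
      ← Real.rpow_natCast, ← Real.rpow_mul hw'.le]
    congr 3
    · ring
    · rw [Finset.sum_neg_distrib, Finset.mul_sum, Finset.sum_div]
  rw [setLIntegral_congr_fun measurableSet_Ioi hw, lintegral_precision hb hs', blockLog,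
    Real.exp_add (Real.log _), Real.exp_log (by positivity), ENNReal.ofReal_mul (by positivity)]

/-! ### The marginal density of the blockwise Stein prior -/

lemma measurable_zeroExtend (d : ℕ) : Measurable (zeroExtend d) := by
  refine measurable_pi_lambda _ fun i => ?_
  unfold zeroExtend
  split_ifs <;> fun_prop

section Stein
variable {d : ℕ} (c : Composition d)

instance : SFinite (steinPrior c) := by
  unfold steinPrior; infer_instance

lemma ae_steinPrior : ∀ᵐ θ ∂(steinPrior c), ∀ i, d ≤ i → θ i = 0 := by
  rw [ae_all_iff]
  intro i
  have hm : MeasurableSet {θ : ℕ → ℝ | d ≤ i → θ i = 0} := by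
    by_cases hi : d ≤ i
    · simp only [hi, true_imp_iff]
      exact measurable_pi_apply i (measurableSet_singleton 0)
    · simp [hi]
  rw [steinPrior, ae_map_iff (measurable_zeroExtend d).aemeasurable hm]
  refine ae_of_all _ fun θ hi => ?_
  rw [zeroExtend, dif_neg (by omega)]

lemma measurable_steinDensity : Measurable (steinDensity c) := by
  unfold steinDensity blockNorm
  refine Finset.measurable_prod _ fun j _ => ?_
  have h : Measurable fun θ : Fin d → ℝ =>
      Real.sqrt (∑ k : Fin (c.blocksFun j), θ (c.embedding j k) ^ 2) := by fun_prop
  exact h.pow_const _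

/-- Independent coordinates, grouped into the blocks of a composition, form independent blocks. -/
lemma map_blocks_pi (μ : Fin d → Measure ℝ) [∀ i, IsProbabilityMeasure (μ i)] :
    (Measure.pi μ).map (fun θ j k => θ (c.embedding j k)) =
      Measure.infinitePi fun j => Measure.infinitePi fun k => μ (c.embedding j k) := by
  have h1 := Measure.map_infinitePi_infinitePi_of_inj (P := μ) c.blocksFinEquiv.injective
  have h2 := Measure.infinitePi_map_piCurry (ι := Fin c.length)
    (κ := fun j => Fin (c.blocksFun j)) (X := fun _ _ => ℝ) (fun j k => μ (c.embedding j k))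
  have h3 : Measure.infinitePi (fun i => μ (c.blocksFinEquiv i)) =
      Measure.infinitePi (fun p : (j : Fin c.length) × Fin (c.blocksFun j) =>
        μ (c.embedding p.1 p.2)) := rfl
  rw [← h2, ← h3, ← h1, Measure.map_map (MeasurableEquiv.measurable _) (by fun_prop),
    Measure.infinitePi_eq_pi]
  rfl

/-- The logarithm of the marginal density of the observation `x` with noise variance `s` under the
blockwise Stein prior. -/
def steinLogMarginal (s : ℝ) (x : ℕ → ℝ) : ℝ :=
  ∑ j with 2 < c.blocksFun j, blockLog (c.blocksFun j) s fun k => x (c.embedding j k)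

lemma likelihood_zeroExtend (σ : ℝ) (x : ℕ → ℝ) (θ : Fin d → ℝ) :
    likelihood σ d x (zeroExtend d θ) =
      ∏ i : Fin d, gaussianPDF (x i) (σ ^ 2).toNNReal (θ i) := by
  rw [likelihood, Finset.prod_range]
  refine Finset.prod_congr rfl fun i _ => ?_
  rw [zeroExtend, dif_pos i.2, gaussianPDF, gaussianPDF, gaussianPDFReal_comm]

/-- The likelihood of the observation `x`, as a function of the parameter, is the density of a
Gaussian law with mean `x`; so the marginal density of `x` is an expectation of the prior density,
and it factorizes over the blocks. -/
lemma lintegral_likelihood_steinPrior {σ : ℝ} (hσ : 0 < σ) (x : ℕ → ℝ) :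
    ∫⁻ θ, likelihood σ d x θ ∂(steinPrior c) =
      ENNReal.ofReal (Real.exp (steinLogMarginal c (σ ^ 2) x)) := by
  have hs := toNNReal_sq_ne_zero hσ
  have hmL : Measurable fun θ : Fin d → ℝ =>
      ∏ i : Fin d, gaussianPDF (x i) (σ ^ 2).toNNReal (θ i) := by fun_prop
  have hmS : Measurable fun θ : Fin d → ℝ => ENNReal.ofReal (steinDensity c θ) :=
    (measurable_steinDensity c).ennreal_ofReal
  have h1 : ∫⁻ θ, likelihood σ d x θ ∂(steinPrior c) =
      ∫⁻ θ, ENNReal.ofReal (steinDensity c θ)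
        ∂(Measure.pi fun i : Fin d => gaussianReal (x i) (σ ^ 2).toNNReal) := by
    rw [steinPrior, lintegral_map (measurable_likelihood σ d x) (measurable_zeroExtend d)]
    simp_rw [likelihood_zeroExtend]
    rw [pi_gaussianReal_eq_withDensity _ hs, lintegral_withDensity_eq_lintegral_mul _ hmS hmL,
      lintegral_withDensity_eq_lintegral_mul _ hmL hmS]
    simp_rw [mul_comm]
  let F : (j : Fin c.length) → (Fin (c.blocksFun j) → ℝ) → ℝ≥0∞ := fun j θ =>
    ENNReal.ofReal (√(∑ k, θ k ^ 2) ^ (2 - (c.blocksFun j : ℤ)))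
  have hF : ∀ j, Measurable (F j) := by
    intro j
    have h : Measurable fun θ : Fin (c.blocksFun j) → ℝ => √(∑ k, θ k ^ 2) := by fun_prop
    exact (h.pow_const _).ennreal_ofReal
  have h2 : ∀ θ : Fin d → ℝ, ENNReal.ofReal (steinDensity c θ) =
      ∏ j with 2 < c.blocksFun j, F j fun k => θ (c.embedding j k) := by
    intro θ
    rw [steinDensity, ENNReal.ofReal_prod_of_nonneg fun j _ =>
      zpow_nonneg (show 0 ≤ blockNorm c θ j from Real.sqrt_nonneg _) _]
    rfl
  have hG : Measurable fun y : (j : Fin c.length) → Fin (c.blocksFun j) → ℝ =>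
      ∏ j with 2 < c.blocksFun j, F j (y j) :=
    Finset.measurable_prod _ fun j _ => (hF j).comp (measurable_pi_apply j)
  rw [h1]
  simp_rw [h2]
  rw [← lintegral_map (f := fun y : (j : Fin c.length) → Fin (c.blocksFun j) → ℝ =>
      ∏ j with 2 < c.blocksFun j, F j (y j))
      (g := fun (θ : Fin d → ℝ) j k => θ (c.embedding j k)) hG (by fun_prop), map_blocks_pi,
    lintegral_prod_infinitePi _ _ hF, steinLogMarginal, Real.exp_sum,
    ENNReal.ofReal_prod_of_nonneg fun _ _ => (Real.exp_pos _).le]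
  refine Finset.prod_congr rfl fun j hj => ?_
  rw [Finset.mem_filter] at hj
  rw [Measure.infinitePi_eq_pi, lintegral_zpow_norm_gaussian hj.2 hs,
    Real.coe_toNNReal _ (sq_nonneg _)]

end Stein

/-- The block `(x_i)_{i ∈ e}` of an observation of `θ` with noise level `σ` is the affine image
`θ + σ x` of a standard Gaussian vector. -/
lemma map_block_seqLaw (σ : ℝ) (θ : ℕ → ℝ) {b : ℕ} {e : Fin b → ℕ} (he : Function.Injective e) :
    (seqLaw σ θ).map (fun x k => x (e k)) =
      (stdGauss (Fin b)).map fun x k => σ * x k + θ (e k) := by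
  have h1 := Measure.map_infinitePi_infinitePi_of_inj
    (P := fun i => gaussianReal (θ i) (σ ^ 2).toNNReal) he
  have h2 := Measure.pi_map_pi (μ := fun _ : Fin b => gaussianReal 0 1)
    (f := fun k x => σ * x + θ (e k)) (fun _ => by fun_prop)
  have h3 : ∀ k, (gaussianReal 0 1).map (fun x => σ * x + θ (e k)) =
      gaussianReal (θ (e k)) (σ ^ 2).toNNReal := by
    intro k
    rw [show (fun x => σ * x + θ (e k)) = (fun x => x + θ (e k)) ∘ (fun x => σ * x) from rfl,
      ← Measure.map_map (by fun_prop) (by fun_prop), gaussianReal_map_const_mul,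
      gaussianReal_map_add_const]
    congr 1
    · ring
    · ext
      rw [Real.coe_toNNReal _ (sq_nonneg _)]
      simp
  simp only [h3] at h2
  rw [seqLaw, h1, stdGauss, h2, Measure.infinitePi_eq_pi]

lemma measurable_affine (σ : ℝ) {b : ℕ} (v : Fin b → ℝ) :
    Measurable fun (x : Fin b → ℝ) k => σ * x k + v k := by fun_prop

lemma measurable_block {b : ℕ} (e : Fin b → ℕ) : Measurable fun (x : ℕ → ℝ) k => x (e k) := by
  fun_prop

section BlockLog
variable {b : ℕ} (hb : 2 < b) {σ : ℝ} (hσ : 0 < σ) (θ : ℕ → ℝ) {e : Fin b → ℕ}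
  (he : Function.Injective e)

lemma measurable_blockLog {b : ℕ} (hb : 2 < b) (s : ℝ) : Measurable (blockLog b s) := by
  unfold blockLog
  have h := (shrinkageProfile_steinLog hb).continuous.measurable
  exact ((h.comp (by fun_prop)).const_add _).const_add _

lemma blockLog_affine {σ : ℝ} (hσ : 0 < σ) (θ : ℕ → ℝ) (e : Fin b → ℕ) (x : Fin b → ℝ) :
    blockLog b (σ ^ 2) (fun k => σ * x k + θ (e k)) =
      Real.log (2 ^ ((b : ℝ) / 2 - 1) * Real.Gamma ((b : ℝ) / 2 - 1))⁻¹ +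
        (1 - (b : ℝ) / 2) * Real.log (σ ^ 2) +
        steinLog b (shiftSq (fun k => θ (e k)) σ⁻¹ x) := by
  rw [blockLog, shiftSq, ← add_assoc, Finset.sum_div]
  congr 2
  refine Finset.sum_congr rfl fun k _ => ?_
  field_simp
  ring

include hb hσ he

lemma integrable_blockLog :
    Integrable (fun x : ℕ → ℝ => blockLog b (σ ^ 2) fun k => x (e k)) (seqLaw σ θ) := by
  have hm := measurable_blockLog hb (σ ^ 2)
  have h1 : Integrable (blockLog b (σ ^ 2)) ((seqLaw σ θ).map (fun x k => x (e k))) := by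
    rw [map_block_seqLaw σ θ he, integrable_map_measure hm.aestronglyMeasurable
      (measurable_affine σ _).aemeasurable]
    refine Integrable.congr ?_ (ae_of_all _ fun x => (blockLog_affine hσ θ e x).symm)
    exact (integrable_const _).add ((shrinkageProfile_steinLog hb).integrable_comp_shiftSq _ _)
  exact (integrable_map_measure hm.aestronglyMeasurable (measurable_block e).aemeasurable).1 h1

lemma integral_blockLog :
    ∫ x, blockLog b (σ ^ 2) (fun k => x (e k)) ∂(seqLaw σ θ) =
      Real.log (2 ^ ((b : ℝ) / 2 - 1) * Real.Gamma ((b : ℝ) / 2 - 1))⁻¹ +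
        (1 - (b : ℝ) / 2) * Real.log (σ ^ 2) +
        ∫ x, steinLog b (shiftSq (fun k => θ (e k)) σ⁻¹ x) ∂(stdGauss (Fin b)) := by
  have hm := measurable_blockLog hb (σ ^ 2)
  rw [← integral_map (measurable_block e).aemeasurable hm.aestronglyMeasurable,
    map_block_seqLaw σ θ he,
    integral_map (measurable_affine σ _).aemeasurable hm.aestronglyMeasurable]
  simp_rw [blockLog_affine hσ θ e]
  rw [integral_add (integrable_const _)
    ((shrinkageProfile_steinLog hb).integrable_comp_shiftSq _ _)]
  simp

end BlockLog

/-! ### The marginal density of a Gaussian prior -/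

/-- The logarithm of the marginal density of the observation `x` with noise level `σ` under the
Gaussian prior with scales `τ`. -/
def gaussianLogMarginal (σ : ℝ) (d : ℕ) (τ x : ℕ → ℝ) : ℝ :=
  ∑ i ∈ Finset.range d,
    Real.log (gaussianPDFReal 0 ((σ ^ 2).toNNReal + (τ i ^ 2).toNNReal) (x i))

lemma ae_gaussianPrior {d : ℕ} {τ : ℕ → ℝ} (hτ : ∀ i, d ≤ i → τ i = 0) :
    ∀ᵐ θ ∂(gaussianPrior τ), ∀ i, d ≤ i → θ i = 0 := by
  rw [ae_all_iff]
  intro i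
  by_cases hi : d ≤ i
  · have h1 : ∀ᵐ y ∂(gaussianReal 0 (τ i ^ 2).toNNReal), y = 0 := by
      rw [hτ i hi]
      simp only [ne_eq, OfNat.ofNat_ne_zero, not_false_eq_true, zero_pow, Real.toNNReal_zero,
        gaussianReal_zero_var]
      exact (ae_dirac_iff (measurableSet_singleton (0 : ℝ))).2 rfl
    filter_upwards [(measurePreserving_eval_infinitePi
      (fun i => gaussianReal 0 (τ i ^ 2).toNNReal) i).quasiMeasurePreserving.ae h1] with θ hθ _
    exact hθ
  · exact ae_of_all _ fun θ h => absurd h hi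

lemma lintegral_likelihood_gaussianPrior {σ : ℝ} (hσ : 0 < σ) (d : ℕ) (τ x : ℕ → ℝ) :
    ∫⁻ θ, likelihood σ d x θ ∂(gaussianPrior τ) =
      ENNReal.ofReal (Real.exp (gaussianLogMarginal σ d τ x)) := by
  have hs := toNNReal_sq_ne_zero hσ
  unfold likelihood gaussianPrior gaussianLogMarginal
  rw [lintegral_prod_infinitePi _ _ (f := fun i a => gaussianPDF a (σ ^ 2).toNNReal (x i))
    (fun i => by fun_prop), Real.exp_sum,
    ENNReal.ofReal_prod_of_nonneg fun _ _ => (Real.exp_pos _).le]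
  refine Finset.prod_congr rfl fun i _ => ?_
  rw [lintegral_gaussianPDF_gaussianReal hs,
    Real.exp_log (gaussianPDFReal_pos _ _ _ (by positivity)), gaussianPDF]

section GaussianLog
variable {σ : ℝ} (hσ : 0 < σ) (d : ℕ) (τ θ : ℕ → ℝ)

lemma measurable_gaussianLogMarginal (σ : ℝ) (d : ℕ) (τ : ℕ → ℝ) :
    Measurable (gaussianLogMarginal σ d τ) := by
  unfold gaussianLogMarginal
  refine Finset.measurable_sum _ fun i _ => Real.measurable_log.comp ?_
  exact (measurable_gaussianPDFReal _ _).comp (measurable_pi_apply i)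

include hσ

lemma log_gaussianPDFReal_toNNReal (t x : ℝ) :
    Real.log (gaussianPDFReal 0 ((σ ^ 2).toNNReal + (t ^ 2).toNNReal) x) =
      -(Real.log (2 * Real.pi * (σ ^ 2 + t ^ 2)) / 2) - (x - 0) ^ 2 / (2 * (σ ^ 2 + t ^ 2)) := by
  have hs := toNNReal_sq_ne_zero hσ
  rw [log_gaussianPDFReal _ (by positivity), NNReal.coe_add, Real.coe_toNNReal _ (sq_nonneg _),
    Real.coe_toNNReal _ (sq_nonneg _)]

lemma integrable_log_gaussianPDFReal (t : ℝ) (i : ℕ) :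
    Integrable (fun x : ℕ → ℝ =>
      Real.log (gaussianPDFReal 0 ((σ ^ 2).toNNReal + (t ^ 2).toNNReal) (x i)))
      (seqLaw σ θ) := by
  simp_rw [log_gaussianPDFReal_toNNReal hσ]
  exact (integrable_const _).sub ((integrable_eval_seqLaw (f := fun x => (x - 0) ^ 2)
    (by fun_prop) (integrable_sq_sub_gaussianReal _ _ _)).div_const _)

lemma integrable_gaussianLogMarginal :
    Integrable (gaussianLogMarginal σ d τ) (seqLaw σ θ) :=
  integrable_finsetSum _ fun i _ => integrable_log_gaussianPDFReal hσ θ (τ i) i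

lemma integral_gaussianLogMarginal :
    ∫ x, gaussianLogMarginal σ d τ x ∂(seqLaw σ θ) =
      ∑ i ∈ Finset.range d, (-(Real.log (2 * Real.pi * (σ ^ 2 + τ i ^ 2)) / 2) -
        (σ ^ 2 + θ i ^ 2) / (2 * (σ ^ 2 + τ i ^ 2))) := by
  unfold gaussianLogMarginal
  rw [integral_finsetSum _ fun i _ => integrable_log_gaussianPDFReal hσ θ (τ i) i]
  refine Finset.sum_congr rfl fun i _ => ?_
  simp_rw [log_gaussianPDFReal_toNNReal hσ]
  rw [integral_sub (integrable_const _) ((integrable_eval_seqLaw (f := fun x => (x - 0) ^ 2)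
    (by fun_prop) (integrable_sq_sub_gaussianReal _ _ _)).div_const _), integral_div,
    integral_eval_seqLaw σ θ i (f := fun x => (x - 0) ^ 2) (by fun_prop),
    integral_sq_sub_gaussianReal, Real.coe_toNNReal _ (sq_nonneg _)]
  simp

end GaussianLog

/-! ### The risk of Gaussian priors -/

/-- Half the decrease of `1 / (s + t)` between the noise variances `v` and `w`: the factor of `θ_i²`
in the risk of the Gaussian prior with variance `t`. -/
def biasCoeff (v w t : ℝ) : ℝ := (1 / (v + t) - 1 / (w + t)) / 2

/-- The part of the risk of the Gaussian prior with variance `t` that does not depend on the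
parameter. -/
def varianceTerm (v w t : ℝ) : ℝ :=
  (Real.log (w / v) - Real.log ((w + t) / (v + t)) - w / (w + t) + v / (v + t)) / 2

section Scalar
variable {v w : ℝ} (hv : 0 < v) (hvw : v ≤ w)
include hv hvw

lemma biasCoeff_nonneg {t : ℝ} (ht : 0 ≤ t) : 0 ≤ biasCoeff v w t := by
  unfold biasCoeff
  have := one_div_le_one_div_of_le (by linarith : 0 < v + t) (by linarith : v + t ≤ w + t)
  linarith

lemma biasCoeff_anti {t u : ℝ} (ht : 0 ≤ t) (htu : t ≤ u) : biasCoeff v w u ≤ biasCoeff v w t := by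
  have hw : 0 < w := hv.trans_le hvw
  have h : ∀ x : ℝ, 0 ≤ x → biasCoeff v w x = (w - v) / (2 * ((v + x) * (w + x))) := by
    intro x hx
    unfold biasCoeff
    have h1 : 0 < v + x := by linarith
    have h2 : 0 < w + x := by linarith
    field_simp
    ring
  rw [h u (ht.trans htu), h t ht]
  have h3 : 0 ≤ w - v := sub_nonneg.2 hvw
  have h4 : 0 < v + t := by linarith
  have h5 : 0 < w + t := by linarith
  have h6 : 0 < v + u := by linarith
  gcongr

lemma varianceTerm_mono {t u : ℝ} (ht : 0 ≤ t) (htu : t ≤ u) :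
    varianceTerm v w t ≤ varianceTerm v w u := by
  have hw : 0 < w := hv.trans_le hvw
  have key : ∀ (a : ℝ), 0 < a → ∀ t ∈ Set.Ici (0 : ℝ),
      HasDerivAt (fun t => Real.log (a + t) + a / (a + t)) (t / (a + t) ^ 2) t := by
    intro a ha t ht
    have hat : 0 < a + t := by
      have := Set.mem_Ici.1 ht
      linarith
    have h1 : HasDerivAt (fun t => a + t) 1 t := (hasDerivAt_id t).const_add a
    refine ((h1.log hat.ne').add ((hasDerivAt_const t a).fun_div h1 hat.ne')).congr_deriv ?_
    field_simp
    ring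
  have hmono : MonotoneOn (fun t => Real.log (v + t) + v / (v + t) -
      (Real.log (w + t) + w / (w + t))) (Set.Ici 0) := by
    refine monotoneOn_of_hasDerivWithinAt_nonneg (convex_Ici 0)
      (f' := fun t => t / (v + t) ^ 2 - t / (w + t) ^ 2)
      (fun t ht => ((key v hv t ht).sub (key w hw t ht)).continuousAt.continuousWithinAt)
      (fun t ht => ((key v hv t (interior_subset ht)).sub
        (key w hw t (interior_subset ht))).hasDerivWithinAt) fun t ht => ?_
    rw [interior_Ici, Set.mem_Ioi] at ht
    have : t / (w + t) ^ 2 ≤ t / (v + t) ^ 2 := by gcongr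
    linarith
  have h := hmono (Set.mem_Ici.2 ht) (Set.mem_Ici.2 (ht.trans htu)) htu
  simp only at h
  unfold varianceTerm
  rw [Real.log_div (by linarith) (by linarith), Real.log_div (by linarith) (by linarith),
    Real.log_div (by linarith) (by linarith)]
  linarith

lemma varianceTerm_nonneg {t : ℝ} (ht : 0 ≤ t) : 0 ≤ varianceTerm v w t := by
  refine le_trans (le_of_eq ?_) (varianceTerm_mono hv hvw le_rfl ht)
  have hw : 0 < w := hv.trans_le hvw
  simp [varianceTerm, div_self hv.ne', div_self hw.ne']

lemma varianceTerm_le {t : ℝ} (ht : 0 ≤ t) : varianceTerm v w t ≤ Real.log (w / v) / 2 := by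
  have hw : 0 < w := hv.trans_le hvw
  have h1 : 0 ≤ Real.log ((w + t) / (v + t)) :=
    Real.log_nonneg ((one_le_div (by linarith)).2 (by linarith))
  have h2 : v / (v + t) ≤ w / (w + t) := by
    rw [div_le_div_iff₀ (by linarith) (by linarith)]
    nlinarith
  unfold varianceTerm
  linarith

/-- The logarithmic bound for the Stein prior is at most the risk of every Gaussian prior that is
constant on the block: at each noise level this is the bound of the risk of the best linear
estimator by the risk of any linear estimator. -/
lemma log_sub_log_le {n B T t : ℝ} (hn : 0 < n) (hnB : n ≤ B) (hT : 0 ≤ T) (ht : 0 ≤ t) :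
    n / 2 * (Real.log (n + v⁻¹ * T) - Real.log (n + w⁻¹ * T)) ≤
      T * biasCoeff v w t + B * varianceTerm v w t := by
  have hw : 0 < w := hv.trans_le hvw
  have hpos : ∀ s : ℝ, 0 < s → 0 < n + s⁻¹ * T := fun s hs => by positivity
  have hder : ∀ s ∈ Set.Ioi (0 : ℝ), HasDerivAt (fun s => n / 2 * Real.log (n + s⁻¹ * T) +
      n / 2 * (Real.log s - Real.log (s + t) - s / (s + t)) - T / 2 * (s + t)⁻¹)
      (n / 2 * (-(s ^ 2)⁻¹ * T / (n + s⁻¹ * T)) +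
        n / 2 * (s⁻¹ - 1 / (s + t) - (1 * (s + t) - s * 1) / (s + t) ^ 2) -
        T / 2 * (-1 / (s + t) ^ 2)) s := by
    intro s hs
    have hs0 : 0 < s := hs
    have hst : 0 < s + t := by linarith
    have h1 : HasDerivAt (fun s : ℝ => n + s⁻¹ * T) (-(s ^ 2)⁻¹ * T) s :=
      ((hasDerivAt_inv hs0.ne').mul_const T).const_add n
    have h2 : HasDerivAt (fun s => s + t) 1 s := (hasDerivAt_id s).add_const t
    exact ((((h1.log (hpos s hs0).ne').const_mul _).add
      ((((Real.hasDerivAt_log hs0.ne').sub (h2.log hst.ne')).sub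
        ((hasDerivAt_id s).fun_div h2 hst.ne')).const_mul _))).sub
      ((h2.fun_inv hst.ne').const_mul _)
  have hmono : MonotoneOn (fun s => n / 2 * Real.log (n + s⁻¹ * T) +
      n / 2 * (Real.log s - Real.log (s + t) - s / (s + t)) - T / 2 * (s + t)⁻¹)
      (Set.Ioi 0) := by
    refine monotoneOn_of_hasDerivWithinAt_nonneg (convex_Ioi 0)
      (fun s hs => (hder s hs).continuousAt.continuousWithinAt)
      (fun s hs => (hder s (interior_subset hs)).hasDerivWithinAt) fun s hs => ?_
    rw [interior_Ioi, Set.mem_Ioi] at hs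
    have hst : 0 < s + t := by linarith
    have hns : 0 < n * s + T := by positivity
    have he : n / 2 * (-(s ^ 2)⁻¹ * T / (n + s⁻¹ * T)) +
        n / 2 * (s⁻¹ - 1 / (s + t) - (1 * (s + t) - s * 1) / (s + t) ^ 2) -
        T / 2 * (-1 / (s + t) ^ 2) =
        (T - n * t) ^ 2 / (2 * (n * s + T) * (s + t) ^ 2) := by
      have := hpos s hs
      field_simp
      ring
    rw [he]
    positivity
  have h := hmono (Set.mem_Ioi.2 hv) (Set.mem_Ioi.2 hw) hvw
  have h2 : n * varianceTerm v w t ≤ B * varianceTerm v w t :=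
    mul_le_mul_of_nonneg_right hnB (varianceTerm_nonneg hv hvw ht)
  refine le_trans ?_ (add_le_add_right h2 _)
  simp only at h
  unfold varianceTerm biasCoeff
  rw [Real.log_div (by linarith) (by linarith), Real.log_div (by linarith) (by linarith),
    one_div, one_div]
  linarith

end Scalar

lemma vSqPair_le {ε ε' : ℝ} (hε : 0 < ε) : vSqPair ε ε' ≤ ε ^ 2 := by
  rw [vSqPair, one_div_le (by positivity) (by positivity)]
  have : 0 ≤ 1 / ε' ^ 2 := by positivity
  linarith

/-- The risk of a Gaussian prior, apart from the coordinates beyond the first `d`. -/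
lemma regret_gaussianPrior {ε ε' : ℝ} (hε : 0 < ε) (hε' : 0 < ε') (d : ℕ) (τ θ : ℕ → ℝ) :
    (d : ℝ) / 2 * Real.log (vSq ε / vSqPair ε ε') +
        ∫ x, gaussianLogMarginal ε d τ x ∂(seqLaw ε θ) -
        ∫ x, gaussianLogMarginal (Real.sqrt (vSqPair ε ε')) d τ x
          ∂(seqLaw (Real.sqrt (vSqPair ε ε')) θ) =
      ∑ i ∈ Finset.range d, (θ i ^ 2 * biasCoeff (vSqPair ε ε') (ε ^ 2) (τ i ^ 2) +
        varianceTerm (vSqPair ε ε') (ε ^ 2) (τ i ^ 2)) := by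
  have hv : 0 < vSqPair ε ε' := vSqPair_pos hε hε'
  have hL : (d : ℝ) / 2 * Real.log (vSq ε / vSqPair ε ε') =
      ∑ i ∈ Finset.range d, Real.log (vSq ε / vSqPair ε ε') / 2 := by
    rw [Finset.sum_const, Finset.card_range, nsmul_eq_mul]
    ring
  rw [integral_gaussianLogMarginal hε, integral_gaussianLogMarginal (Real.sqrt_pos.2 hv), hL,
    Real.sq_sqrt hv.le, ← Finset.sum_add_distrib, ← Finset.sum_sub_distrib]
  generalize vSqPair ε ε' = v at *
  refine Finset.sum_congr rfl fun i _ => ?_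
  have hw : 0 < ε ^ 2 := by positivity
  have hvt : 0 < v + τ i ^ 2 := by positivity
  have hwt : 0 < ε ^ 2 + τ i ^ 2 := by positivity
  unfold varianceTerm biasCoeff vSq
  rw [Real.log_mul (by positivity) hvt.ne', Real.log_mul (by positivity) hwt.ne',
    Real.log_div hwt.ne' hvt.ne']
  field_simp
  ring

/-! ### The risk of the blockwise Stein prior -/

lemma measurable_steinLogMarginal {d : ℕ} (c : Composition d) (s : ℝ) :
    Measurable (steinLogMarginal c s) := by
  unfold steinLogMarginal
  refine Finset.measurable_sum _ fun j hj => ?_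
  exact (measurable_blockLog (Finset.mem_filter.1 hj).2 s).comp (by fun_prop)

lemma embedding_val_injective {d : ℕ} (c : Composition d) (j : Fin c.length) :
    Function.Injective fun k => ((c.embedding j k : Fin d) : ℕ) :=
  Fin.val_injective.comp (c.embedding j).injective

lemma integrable_steinLogMarginal {d : ℕ} (c : Composition d) {σ : ℝ} (hσ : 0 < σ) (θ : ℕ → ℝ) :
    Integrable (steinLogMarginal c (σ ^ 2)) (seqLaw σ θ) :=
  integrable_finsetSum _ fun j hj =>
    integrable_blockLog (Finset.mem_filter.1 hj).2 hσ θ (embedding_val_injective c j)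

lemma integral_steinLogMarginal {d : ℕ} (c : Composition d) {σ : ℝ} (hσ : 0 < σ) (θ : ℕ → ℝ) :
    ∫ x, steinLogMarginal c (σ ^ 2) x ∂(seqLaw σ θ) =
      ∑ j with 2 < c.blocksFun j, ∫ x, blockLog (c.blocksFun j) (σ ^ 2)
        (fun k => x (c.embedding j k)) ∂(seqLaw σ θ) :=
  integral_finsetSum _ fun j hj =>
    integrable_blockLog (Finset.mem_filter.1 hj).2 hσ θ (embedding_val_injective c j)

/-- Up to one unit of `log (w / v)`, with `w = ε²` and `v = vSqPair ε ε'`, the Stein prior does as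
well on a block as every Gaussian prior with a common variance `t` on the block. -/
lemma block_regret_le {ε ε' : ℝ} (hε : 0 < ε) (hε' : 0 < ε') {b : ℕ} (hb : 2 < b) (θ : ℕ → ℝ)
    {e : Fin b → ℕ} (he : Function.Injective e) {t : ℝ} (ht : 0 ≤ t) :
    (b : ℝ) / 2 * Real.log (vSq ε / vSqPair ε ε') +
        (∫ x, blockLog b (ε ^ 2) (fun k => x (e k)) ∂(seqLaw ε θ) -
        ∫ x, blockLog b (Real.sqrt (vSqPair ε ε') ^ 2) (fun k => x (e k))
          ∂(seqLaw (Real.sqrt (vSqPair ε ε')) θ)) ≤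
      Real.log (vSq ε / vSqPair ε ε') +
        (∑ k, θ (e k) ^ 2) * biasCoeff (vSqPair ε ε') (ε ^ 2) t +
        b * varianceTerm (vSqPair ε ε') (ε ^ 2) t := by
  have hv : 0 < vSqPair ε ε' := vSqPair_pos hε hε'
  have hvw : vSqPair ε ε' ≤ ε ^ 2 := vSqPair_le hε
  have hs : 0 < Real.sqrt (vSqPair ε ε') := Real.sqrt_pos.2 hv
  have hb' : (2 : ℝ) < b := by exact_mod_cast hb
  rw [integral_blockLog hb hε θ he, integral_blockLog hb hs θ he]
  have h1 := (shrinkageProfile_steinLog hb).integral_sub_le (fun k => θ (e k)) (a := ε⁻¹)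
    (b := (Real.sqrt (vSqPair ε ε'))⁻¹) (by simp) (by linarith) (by positivity)
    (by
      gcongr
      exact Real.sqrt_le_iff.2 ⟨hε.le, hvw⟩)
  have h2 := log_sub_log_le hv hvw (n := (b : ℝ) - 2) (B := b) (T := ∑ k, θ (e k) ^ 2) (t := t)
    (by linarith) (by linarith) (by positivity) ht
  -- The normalizing constants of the two marginal densities cancel, and their powers of the noise
  -- variance replace the factor `b / 2` of `log (w / v)` by `1`.
  rw [inv_pow, inv_pow, Real.sq_sqrt hv.le] at h1
  rw [Real.sq_sqrt hv.le, vSq, Real.log_div (by positivity) hv.ne']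
  linarith

/-- Each block costs at most one unit of `log (w / v)` over a Gaussian prior that is constant on the
blocks. -/
lemma regret_steinPrior_le {ε ε' : ℝ} (hε : 0 < ε) (hε' : 0 < ε') {d : ℕ} (c : Composition d)
    (θ : ℕ → ℝ) {t : Fin c.length → ℝ} (ht : ∀ j, 0 ≤ t j) :
    (d : ℝ) / 2 * Real.log (vSq ε / vSqPair ε ε') +
        ∫ x, steinLogMarginal c (ε ^ 2) x ∂(seqLaw ε θ) -
        ∫ x, steinLogMarginal c (Real.sqrt (vSqPair ε ε') ^ 2) x
          ∂(seqLaw (Real.sqrt (vSqPair ε ε')) θ) ≤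
      ∑ j, (Real.log (vSq ε / vSqPair ε ε') +
        (∑ k, θ (c.embedding j k) ^ 2) * biasCoeff (vSqPair ε ε') (ε ^ 2) (t j) +
        c.blocksFun j * varianceTerm (vSqPair ε ε') (ε ^ 2) (t j)) := by
  have hv : 0 < vSqPair ε ε' := vSqPair_pos hε hε'
  have hvw : vSqPair ε ε' ≤ ε ^ 2 := vSqPair_le hε
  have hL : 0 ≤ Real.log (vSq ε / vSqPair ε ε') :=
    Real.log_nonneg ((one_le_div hv).2 hvw)
  have hd : (d : ℝ) = ∑ j, (c.blocksFun j : ℝ) := by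
    exact_mod_cast c.sum_blocksFun.symm
  rw [integral_steinLogMarginal c hε, integral_steinLogMarginal c (Real.sqrt_pos.2 hv),
    add_sub_assoc, ← Finset.sum_sub_distrib, Finset.sum_filter, hd, Finset.sum_div, Finset.sum_mul,
    ← Finset.sum_add_distrib]
  refine Finset.sum_le_sum fun j _ => ?_
  split_ifs with hj
  · exact block_regret_le hε hε' hj θ (embedding_val_injective c j) (ht j)
  · have hj' : (c.blocksFun j : ℝ) ≤ 2 := by exact_mod_cast not_lt.1 hj
    have h1 : 0 ≤ (∑ k, θ (c.embedding j k) ^ 2) * biasCoeff (vSqPair ε ε') (ε ^ 2) (t j) :=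
      mul_nonneg (by positivity) (biasCoeff_nonneg hv hvw (ht j))
    have h2 : 0 ≤ (c.blocksFun j : ℝ) * varianceTerm (vSqPair ε ε') (ε ^ 2) (t j) :=
      mul_nonneg (by positivity) (varianceTerm_nonneg hv hvw (ht j))
    nlinarith

/-! ### Blockwise constant variances compared with monotone variances -/

/-- If every term but the first is controlled by its predecessor in another sum, then the sum is
controlled up to the first term. -/
lemma sum_le_add_mul_sum {m : ℕ} {x y : Fin (m + 1) → ℝ} {C K : ℝ} (hK : 0 ≤ K) (hy : ∀ j, 0 ≤ y j)
    (h0 : x 0 ≤ C) (h : ∀ j : Fin m, x j.succ ≤ K * y j.castSucc) :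
    ∑ j, x j ≤ C + K * ∑ j, y j := by
  rw [Fin.sum_univ_succ, Fin.sum_univ_castSucc (f := y), mul_add, Finset.mul_sum]
  have h1 := Finset.sum_le_sum fun j (_ : j ∈ Finset.univ) => h j
  have h2 := mul_nonneg hK (hy (Fin.last m))
  linarith

lemma sum_range_eq_sum_blocks {d : ℕ} (c : Composition d) (f : ℕ → ℝ) :
    ∑ i ∈ Finset.range d, f i = ∑ j, ∑ k, f (c.embedding j k) := by
  rw [Finset.sum_range, ← c.blocksFinEquiv.sum_comp, Fintype.sum_sigma]
  rfl

/-- Every index of a block precedes the first index of the next block. -/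
lemma embedding_le_embedding_succ {d : ℕ} (c : Composition d) {j : ℕ} (hj : j + 1 < c.length)
    (k : Fin (c.blocksFun ⟨j, Nat.lt_of_succ_lt hj⟩)) (l : Fin (c.blocksFun ⟨j + 1, hj⟩)) :
    (c.embedding ⟨j, Nat.lt_of_succ_lt hj⟩ k : ℕ) ≤ c.embedding ⟨j + 1, hj⟩ l := by
  rw [Composition.coe_embedding, Composition.coe_embedding]
  have h := c.sizeUpTo_succ' ⟨j, Nat.lt_of_succ_lt hj⟩
  have h' := k.2
  simp only at h ⊢
  omega

/-- With the largest of the monotone variances on each block, the bias terms decrease; the variance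
terms of a block are at most `1 + η` times those of the preceding block, and the first block
contributes at most `b₁ / 2 * log (w / v)`. -/
lemma regret_blockwise_le_regret_monotone {v w : ℝ} (hv : 0 < v) (hvw : v ≤ w) {d : ℕ} (hd : 0 < d)
    (c : Composition d) {η : ℝ} (hη : 0 < η)
    (hc : ∀ (j : ℕ) (hj : j + 1 < c.length),
      (c.blocksFun ⟨j + 1, hj⟩ : ℝ) / (c.blocksFun ⟨j, Nat.lt_of_succ_lt hj⟩ : ℝ) ≤ 1 + η)
    {τ : ℕ → ℝ} (hτ : τ ∈ monotoneScales d) (θ : ℕ → ℝ) :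
    ∑ j, (Real.log (w / v) + (∑ k, θ (c.embedding j k) ^ 2) *
          biasCoeff v w (τ (c.embedding j ⟨0, c.blocks_pos' j.1 j.2⟩) ^ 2) +
        c.blocksFun j * varianceTerm v w (τ (c.embedding j ⟨0, c.blocks_pos' j.1 j.2⟩) ^ 2)) ≤
      (1 + η) * ∑ i ∈ Finset.range d,
          (θ i ^ 2 * biasCoeff v w (τ i ^ 2) + varianceTerm v w (τ i ^ 2)) +
        ((c.length : ℝ) + (c.blocksFun ⟨0, c.length_pos_of_pos hd⟩ : ℝ) / 2) *
          Real.log (w / v) := by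
  obtain ⟨hmono, hnn, -⟩ := hτ
  have hsq : ∀ i j, i ≤ j → j < d → τ j ^ 2 ≤ τ i ^ 2 := fun i j hij hj =>
    pow_le_pow_left₀ (hnn j hj) (hmono i j hij hj) 2
  have hbias : ∑ j, (∑ k, θ (c.embedding j k) ^ 2) *
        biasCoeff v w (τ (c.embedding j ⟨0, c.blocks_pos' j.1 j.2⟩) ^ 2) ≤
      (1 + η) * ∑ i ∈ Finset.range d, θ i ^ 2 * biasCoeff v w (τ i ^ 2) := by
    have h0 : 0 ≤ ∑ i ∈ Finset.range d, θ i ^ 2 * biasCoeff v w (τ i ^ 2) :=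
      Finset.sum_nonneg fun i _ =>
        mul_nonneg (sq_nonneg _) (biasCoeff_nonneg hv hvw (sq_nonneg _))
    refine le_trans ?_ (le_mul_of_one_le_left h0 (by linarith))
    rw [sum_range_eq_sum_blocks c]
    refine Finset.sum_le_sum fun j _ => ?_
    rw [Finset.sum_mul]
    refine Finset.sum_le_sum fun k _ => mul_le_mul_of_nonneg_left ?_ (sq_nonneg _)
    refine biasCoeff_anti hv hvw (sq_nonneg _) (hsq _ _ ?_ (c.embedding j k).2)
    rw [Composition.coe_embedding, Composition.coe_embedding]
    simp
  have hvar : ∑ j, (c.blocksFun j : ℝ) *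
        varianceTerm v w (τ (c.embedding j ⟨0, c.blocks_pos' j.1 j.2⟩) ^ 2) ≤
      (c.blocksFun ⟨0, c.length_pos_of_pos hd⟩ : ℝ) / 2 * Real.log (w / v) +
        (1 + η) * ∑ i ∈ Finset.range d, varianceTerm v w (τ i ^ 2) := by
    rw [sum_range_eq_sum_blocks c]
    -- The number of blocks is a successor, so the sums can be shifted against each other.
    obtain ⟨m, hm⟩ : ∃ m, c.length = m + 1 :=
      Nat.exists_eq_succ_of_ne_zero (c.length_pos_of_pos hd).ne'
    rw [← (finCongr hm.symm).sum_comp, ← (finCongr hm.symm).sum_comp]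
    refine sum_le_add_mul_sum (by linarith)
      (fun j => Finset.sum_nonneg fun k _ => varianceTerm_nonneg hv hvw (sq_nonneg _)) ?_ ?_
    · have := varianceTerm_le hv hvw (sq_nonneg
        (τ (c.embedding (finCongr hm.symm 0) ⟨0, c.blocks_pos' _ (finCongr hm.symm 0).2⟩)))
      refine (mul_le_mul_of_nonneg_left this (Nat.cast_nonneg _)).trans (le_of_eq ?_)
      rw [div_mul_eq_mul_div, mul_div_assoc]
      rfl
    · intro j
      have hj : (j : ℕ) + 1 < c.length := by omega
      have hb : 0 < (c.blocksFun ⟨j, Nat.lt_of_succ_lt hj⟩ : ℝ) := by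
        exact_mod_cast c.blocks_pos' _ _
      -- `V` bounds each variance term of block `j` from below and occurs in block `j + 1`.
      set V := varianceTerm v w (τ (c.embedding ⟨j + 1, hj⟩ ⟨0, c.blocks_pos' _ hj⟩) ^ 2)
      have hV : 0 ≤ V := varianceTerm_nonneg hv hvw (sq_nonneg _)
      have h1 : (c.blocksFun ⟨j + 1, hj⟩ : ℝ) * V ≤
          (1 + η) * ((c.blocksFun ⟨j, Nat.lt_of_succ_lt hj⟩ : ℝ) * V) := by
        rw [← mul_assoc]
        exact mul_le_mul_of_nonneg_right ((div_le_iff₀ hb).1 (hc j hj)) hV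
      refine le_trans (b := _) h1 (mul_le_mul_of_nonneg_left ?_ (by linarith))
      have h2 : ∀ k, V ≤ varianceTerm v w
          (τ (c.embedding ⟨j, Nat.lt_of_succ_lt hj⟩ k) ^ 2) := fun k =>
        varianceTerm_mono hv hvw (sq_nonneg _)
          (hsq _ _ (embedding_le_embedding_succ c hj k _) (Fin.is_lt _))
      have h3 := Finset.card_nsmul_le_sum Finset.univ _ V fun k _ => h2 k
      rw [Finset.card_univ, Fintype.card_fin, nsmul_eq_mul] at h3
      exact h3
  simp only [Finset.sum_add_distrib, Finset.sum_const, Finset.card_univ, Fintype.card_fin,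
    nsmul_eq_mul]
  linarith

end SeqPrediction
end

open SeqPrediction in
theorem mainTheorem7 (ε ε' : ℝ) (hε : 0 < ε) (hε' : 0 < ε') (d : ℕ) (hd : 0 < d)
    (c : Composition d) (η : ℝ) (hη : 0 < η)
    (hc : ∀ (j : ℕ) (hj : j + 1 < c.length),
      (c.blocksFun ⟨j + 1, hj⟩ : ℝ) / (c.blocksFun ⟨j, Nat.lt_of_succ_lt hj⟩ : ℝ) ≤ 1 + η)
    (θ : ℕ → ℝ) (hθ : Summable fun i => θ i ^ 2) :
    SeqPrediction.risk ε ε' θ (SeqPrediction.steinPredictive ε ε' c) ≤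
      ENNReal.ofReal (1 + η) *
          (⨅ Q ∈ SeqPrediction.monotoneClass ε ε' d, SeqPrediction.risk ε ε' θ Q) +
        ENNReal.ofReal
          (((c.length : ℝ) + (c.blocksFun ⟨0, c.length_pos_of_pos hd⟩ : ℝ) / 2) *
            Real.log (SeqPrediction.vSq ε / SeqPrediction.vSqPair ε ε')) := by
  have hv : 0 < vSqPair ε ε' := vSqPair_pos hε hε'
  have hvw : vSqPair ε ε' ≤ ε ^ 2 := vSqPair_le hε
  have hs : 0 < Real.sqrt (vSqPair ε ε') := Real.sqrt_pos.2 hv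
  have hK0 : ENNReal.ofReal (1 + η) ≠ 0 := by
    rw [ne_eq, ENNReal.ofReal_eq_zero]
    linarith
  rw [ENNReal.mul_iInf_of_ne hK0 ENNReal.ofReal_ne_top, ENNReal.iInf_add]
  refine le_iInf fun Q => ?_
  rw [ENNReal.mul_iInf_of_ne hK0 ENNReal.ofReal_ne_top, ENNReal.iInf_add]
  refine le_iInf fun hQ => ?_
  obtain ⟨τ, hτ, rfl⟩ := hQ
  -- For square-summable `θ` the divergence `tailDiv ε' d θ` is finite; if it were infinite, both
  -- risks would be infinite and the bound would hold as well.
  by_cases hK : tailDiv ε' d θ = ∞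
  · rw [risk_bayesPredictive_eq_top hε hε' (ae_gaussianPrior hτ.2.2)
      (lintegral_likelihood_gaussianPrior hε d τ) (lintegral_likelihood_gaussianPrior hs d τ)
      (measurable_gaussianLogMarginal _ _ _) (measurable_gaussianLogMarginal _ _ _)
      (integrable_gaussianLogMarginal hε d τ θ) (integrable_gaussianLogMarginal hs d τ θ) hK,
      ENNReal.mul_top hK0, top_add]
    exact le_top
  · rw [risk_bayesPredictive hε hε' (ae_gaussianPrior hτ.2.2)
      (lintegral_likelihood_gaussianPrior hε d τ) (lintegral_likelihood_gaussianPrior hs d τ)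
      (measurable_gaussianLogMarginal _ _ _) (measurable_gaussianLogMarginal _ _ _)
      (integrable_gaussianLogMarginal hε d τ θ) (integrable_gaussianLogMarginal hs d τ θ) hK,
      steinPredictive, risk_bayesPredictive hε hε' (ae_steinPrior c)
      (lintegral_likelihood_steinPrior c hε) (lintegral_likelihood_steinPrior c hs)
      (measurable_steinLogMarginal c _) (measurable_steinLogMarginal c _)
      (integrable_steinLogMarginal c hε θ) (integrable_steinLogMarginal c hs θ) hK,
      regret_gaussianPrior hε hε', ← ENNReal.ofReal_mul (by linarith)]
    refine le_trans (ENNReal.ofReal_le_ofReal ?_) ENNReal.ofReal_add_le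
    have h1 := regret_steinPrior_le hε hε' c θ
      (t := fun j => τ (c.embedding j ⟨0, c.blocks_pos' j.1 j.2⟩) ^ 2) fun j => sq_nonneg _
    have h2 := regret_blockwise_le_regret_monotone hv hvw hd c hη hc hτ θ
    have h3 : 0 ≤ η * (tailDiv ε' d θ).toReal := by positivity
    rw [mul_add]
    unfold vSq at *
    linarith
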